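/- Let $X\in\mathbb{R}^{m\times p}$ be a fixed matrix of rank $q$, let $A\in\mathbb{R}^{p\times n}$ be fixed, and let $Y=XA+E$, where the entries of the random $m\times n$ matrix $E$ are independent $N(0,\sigma^2)$ random variables, $\sigma\ge 0$. Let $d_1(X)$ be the largest singular value of $X$, let $\|\cdot\|_F$ be the Frobenius norm, and let $\|B\|_1$ be the nuclear norm of $B$ (the sum of its singular values). Let $\theta>0$ and put $$\tau=(1+\theta)\,d_1(X)\,\sigma\,(\sqrt n+\sqrt q).$$ Let $\tilde A$ be the nuclear norm penalized (NNP) estimator, that is, a minimizer of $\|Y-XB\|_F^2+2\tau\|B\|_1$ over all $p\times n$ matrices $B$. Then, with probability at least $1-\exp\{-\theta^2(n+q)/2\}$, the inequality $$\|X\tilde A-XA\|_F^2\le\|XB-XA\|_F^2+4\tau\|B\|_1$$ holds simultaneously for all $p\times n$ matrices $B$ and for every choice of the minimizer $\tilde A$. -/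

import Mathlib

open MeasureTheory ProbabilityTheory
open scoped NNReal ENNReal Matrix Matrix.Norms.Frobenius

namespace NuclearNormRegression

/-- The singular values of a real matrix `C`, in decreasing order, with multiplicity, continued by
zeros. They are indexed from zero: the `k`-th largest singular value is `singularValues C (k - 1)`. -/
noncomputable def singularValues {a b : ℕ} (C : Matrix (Fin a) (Fin b) ℝ) : ℕ →₀ ℝ :=
  (Matrix.toEuclideanLin C).singularValues

/-- The largest singular value `d₁(C)`. -/
noncomputable def largestSingularValue {a b : ℕ} (C : Matrix (Fin a) (Fin b) ℝ) : ℝ :=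
  singularValues C 0

/-- The nuclear norm `‖C‖₁`, the sum of the singular values of `C`. -/
noncomputable def nuclearNorm {a b : ℕ} (C : Matrix (Fin a) (Fin b) ℝ) : ℝ :=
  ∑ k ∈ Finset.range (min a b), singularValues C k

/-- The nuclear norm penalized least squares criterion `‖Y - X B‖_F² + 2 τ ‖B‖₁`; the norm `‖·‖` on
matrices is the Frobenius norm. -/
noncomputable def nnpCriterion {m p n : ℕ} (X : Matrix (Fin m) (Fin p) ℝ)
    (Y : Matrix (Fin m) (Fin n) ℝ) (τ : ℝ) (B : Matrix (Fin p) (Fin n) ℝ) : ℝ :=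
  ‖Y - X * B‖ ^ 2 + 2 * τ * nuclearNorm B

/-- `Atilde` is a nuclear norm penalized estimator: it minimizes the criterion over all
`p × n` matrices. -/
def IsNNPEstimator {m p n : ℕ} (X : Matrix (Fin m) (Fin p) ℝ) (Y : Matrix (Fin m) (Fin n) ℝ)
    (τ : ℝ) (Atilde : Matrix (Fin p) (Fin n) ℝ) : Prop :=
  ∀ B : Matrix (Fin p) (Fin n) ℝ, nnpCriterion X Y τ Atilde ≤ nnpCriterion X Y τ B

end NuclearNormRegression

open NuclearNormRegression

/-! Comparing the criterion at the minimizer and at B leaves the noise terms ⟨E, XÃ⟩ and ⟨E, XB⟩. If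
|⟨E, XC⟩| ≤ τ‖C‖₁ for every C, the first is absorbed by the penalty of Ã and the second doubles that
of B (`oracle_inequality_of_abs_sum_mul_le`). Evaluating ⟨E, XC⟩ in a basis of right singular
vectors of C reduces this condition to ⟨x, Ev⟩ ≤ (1+θ)σ(√n+√q) for unit v and unit x in the column
space of X (`abs_sum_mul_le_nuclearNorm`). One event therefore serves all B and all minimizers.

The probability of that event comes from exponential moments alone, without a separate concentration
inequality. For a standard Gaussian matrix G, compare ⟨x, Gv⟩ + ξ, with ξ an independent standard
normal, to ⟨x, g⟩ + ⟨v, h⟩. The variances agree and the covariances differ by (1-⟨x,x'⟩)(1-⟨v,v'⟩) ≥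
0, so Slepian's inequality, proved by Gaussian interpolation and Stein's identity, bounds the
exponential moment of the first supremum by that of |g| + |h|, with g restricted to the column space
(`integral_exp_sup_tensorVec_le`). A norm in dimension k satisfies E exp(c|g|) ≤ exp(c√k + c²/2), by
Stein's identity and a differential inequality in c (`integral_exp_mul_smoothNorm_le`). Dividing by
E exp(lξ) = exp(l²/2) leaves exp(l(√n+√q) + l²/2), and Chernoff's bound with l = θ(√n+√q) concludes.
-/

namespace NuclearNormRegression

/-- The standard Gaussian measure on `κ → ℝ`. -/
noncomputable abbrev gaussPi (κ : Type*) [Fintype κ] : Measure (κ → ℝ) :=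
  Measure.pi fun _ => gaussianReal 0 1

/-! ### Standard Gaussian measure: density, Stein's identity, integrability. -/

section GaussPi

variable {κ κ' : Type*} [Fintype κ] [Fintype κ']

/-- It suffices to compare the measures of boxes: the indicator of a box factors over the
coordinates, and Fubini does the rest. -/
theorem pi_withDensity_ofReal {f : κ → ℝ → ℝ} (hf : ∀ k, Integrable (f k))
    (hf0 : ∀ k x, 0 ≤ f k x) :
    Measure.pi (fun k => (volume : Measure ℝ).withDensity fun x => ENNReal.ofReal (f k x)) =
      (volume : Measure (κ → ℝ)).withDensity fun z => ENNReal.ofReal (∏ k, f k (z k)) := by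
  have (k : κ) : IsFiniteMeasure
      ((volume : Measure ℝ).withDensity fun x => ENNReal.ofReal (f k x)) :=
    isFiniteMeasure_withDensity_ofReal (hf k).2
  refine Measure.pi_eq fun s hs => ?_
  have hind (k : κ) : Integrable ((s k).indicator (f k)) := (hf k).indicator (hs k)
  have hind0 (k : κ) (x : ℝ) : 0 ≤ (s k).indicator (f k) x :=
    Set.indicator_nonneg (fun x _ => hf0 k x) x
  have hprod : ∀ z : κ → ℝ, (Set.univ.pi s).indicator
      (fun z => ENNReal.ofReal (∏ k, f k (z k))) z =
        ENNReal.ofReal (∏ k, (s k).indicator (f k) (z k)) := by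
    intro z
    by_cases hz : z ∈ Set.univ.pi s
    · rw [Set.indicator_of_mem hz]
      congr 1
      refine Finset.prod_congr rfl fun k _ => ?_
      rw [Set.indicator_of_mem (hz k trivial)]
    · rw [Set.indicator_of_notMem hz]
      simp only [Set.mem_pi, Set.mem_univ, true_imp_iff, not_forall] at hz
      obtain ⟨k, hk⟩ := hz
      rw [Finset.prod_eq_zero (Finset.mem_univ k) (Set.indicator_of_notMem hk _),
        ENNReal.ofReal_zero]
  rw [withDensity_apply _ (MeasurableSet.univ_pi hs), ← lintegral_indicator
    (MeasurableSet.univ_pi hs)]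
  simp_rw [hprod]
  have hpi : Integrable fun z : κ → ℝ => ∏ k, (s k).indicator (f k) (z k) :=
    Integrable.fintype_prod hind
  rw [← ofReal_integral_eq_lintegral_ofReal hpi
    (Filter.Eventually.of_forall fun z => Finset.prod_nonneg fun k _ => hind0 k _),
    integral_fintype_prod_volume_eq_prod,
    ENNReal.ofReal_prod_of_nonneg fun k _ => integral_nonneg (hind0 k)]
  refine Finset.prod_congr rfl fun k _ => ?_
  rw [integral_indicator (hs k), withDensity_apply _ (hs k),
    ofReal_integral_eq_lintegral_ofReal (hf k).integrableOn
      (Filter.Eventually.of_forall (hf0 k))]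

/-- The density of the standard Gaussian measure on `κ → ℝ`. -/
noncomputable def gaussPiPDF (z : κ → ℝ) : ℝ := ∏ k, gaussianPDFReal 0 1 (z k)

theorem gaussPiPDF_nonneg (z : κ → ℝ) : 0 ≤ gaussPiPDF z :=
  Finset.prod_nonneg fun _ _ => gaussianPDFReal_nonneg _ _ _

theorem measurable_gaussPiPDF : Measurable (gaussPiPDF (κ := κ)) := by
  unfold gaussPiPDF
  exact Finset.measurable_fun_prod _ fun k _ =>
    (measurable_gaussianPDFReal 0 1).comp (measurable_pi_apply k)

theorem gaussPi_eq_withDensity :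
    gaussPi κ = volume.withDensity fun z => ENNReal.ofReal (gaussPiPDF z) := by
  rw [gaussPi, gaussianReal_of_var_ne_zero _ one_ne_zero]
  exact pi_withDensity_ofReal (fun _ => integrable_gaussianPDFReal 0 1)
    (fun _ _ => gaussianPDFReal_nonneg _ _ _)

theorem integral_gaussPi (F : (κ → ℝ) → ℝ) :
    ∫ z, F z ∂gaussPi κ = ∫ z, gaussPiPDF z * F z := by
  rw [gaussPi_eq_withDensity, integral_withDensity_eq_integral_toReal_smul
    measurable_gaussPiPDF.ennreal_ofReal (Filter.Eventually.of_forall fun _ => ENNReal.ofReal_lt_top)]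
  simp [ENNReal.toReal_ofReal (gaussPiPDF_nonneg _)]

theorem integrable_gaussPi_iff (F : (κ → ℝ) → ℝ) :
    Integrable F (gaussPi κ) ↔ Integrable fun z => gaussPiPDF z * F z := by
  rw [gaussPi_eq_withDensity, integrable_withDensity_iff_integrable_smul'
    measurable_gaussPiPDF.ennreal_ofReal (Filter.Eventually.of_forall fun _ => ENNReal.ofReal_lt_top)]
  simp [ENNReal.toReal_ofReal (gaussPiPDF_nonneg _)]

/-- The density is a constant times exp(-|z|²/2). The factor -⟨v, z⟩ turns Lebesgue integration by
parts into Stein's identity. -/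
theorem hasLineDerivAt_gaussPiPDF (z v : κ → ℝ) :
    HasLineDerivAt ℝ gaussPiPDF (-(v ⬝ᵥ z) * gaussPiPDF z) z v := by
  have hform : ∀ z : κ → ℝ, gaussPiPDF z =
      ((√(2 * Real.pi))⁻¹) ^ Fintype.card κ * Real.exp (-(z ⬝ᵥ z) / 2) := by
    intro z
    simp only [gaussPiPDF, gaussianPDFReal, Finset.prod_mul_distrib, Finset.prod_const,
      ← Real.exp_sum, dotProduct, Finset.card_univ]
    congr 2
    · simp
    · rw [neg_div, Finset.sum_div, ← Finset.sum_neg_distrib]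
      refine Finset.sum_congr rfl fun k _ => ?_
      simp; ring
  unfold HasLineDerivAt
  simp_rw [hform]
  have hd : HasDerivAt (fun t : ℝ => -((z + t • v) ⬝ᵥ (z + t • v)) / 2) (-(v ⬝ᵥ z)) 0 := by
    have : (fun t : ℝ => -((z + t • v) ⬝ᵥ (z + t • v)) / 2) =
        fun t : ℝ => -(z ⬝ᵥ z) / 2 - t * (v ⬝ᵥ z) - t ^ 2 * ((v ⬝ᵥ v) / 2) := by
      ext t
      simp only [add_dotProduct, dotProduct_add, smul_dotProduct, dotProduct_smul, smul_eq_mul,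
        dotProduct_comm z v]
      ring
    rw [this]
    have h := (((hasDerivAt_id (0 : ℝ)).mul_const (v ⬝ᵥ z)).const_sub (-(z ⬝ᵥ z) / 2)).sub
      ((hasDerivAt_pow 2 (0 : ℝ)).mul_const ((v ⬝ᵥ v) / 2))
    convert! h using 1
    simp
  convert! (hd.exp.const_mul (((√(2 * Real.pi))⁻¹) ^ Fintype.card κ)) using 1
  simp; ring

/-- **Stein's identity**: Gaussian integration by parts in the direction `v`. -/
theorem integral_dotProduct_mul_gaussPi {F F' : (κ → ℝ) → ℝ} {v : κ → ℝ}
    (hF : ∀ z, HasLineDerivAt ℝ F (F' z) z v) (hFi : Integrable F (gaussPi κ))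
    (hF'i : Integrable F' (gaussPi κ)) (hvF : Integrable (fun z => (v ⬝ᵥ z) * F z) (gaussPi κ)) :
    ∫ z, (v ⬝ᵥ z) * F z ∂gaussPi κ = ∫ z, F' z ∂gaussPi κ := by
  rw [integrable_gaussPi_iff] at hFi hF'i hvF
  rw [integral_gaussPi, integral_gaussPi]
  have h := integral_bilinear_hasLineDerivAt_right_eq_neg_left_of_integrable
    (μ := (volume : Measure (κ → ℝ))) (B := ContinuousLinearMap.mul ℝ ℝ)
    (f := gaussPiPDF) (f' := fun z => -(v ⬝ᵥ z) * gaussPiPDF z) (g := F) (g' := F') (v := v)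
    (by
      refine hvF.neg.congr (Filter.Eventually.of_forall fun z => ?_)
      simp; ring) hF'i hFi (fun z _ => hasLineDerivAt_gaussPiPDF z v) (fun z _ => hF z)
  simp only [ContinuousLinearMap.mul_apply'] at h
  rw [h, ← integral_neg]
  congr 1
  ext z
  ring

theorem integrable_exp_mul_sum_abs (c : ℝ) :
    Integrable (fun z : κ → ℝ => Real.exp (c * ∑ k, |z k|)) (gaussPi κ) := by
  have h : Integrable (fun x : ℝ => Real.exp (c * |x|)) (gaussianReal 0 1) :=
    integrable_exp_mul_abs (X := id) (integrable_exp_mul_gaussianReal c)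
      (integrable_exp_mul_gaussianReal (-c))
  simp_rw [Finset.mul_sum, Real.exp_sum]
  exact Integrable.fintype_prod (f := fun _ x => Real.exp (c * |x|)) fun _ => h

theorem integrable_exp_gaussPi_of_le {L : (κ → ℝ) → ℝ} (hL : Continuous L) {C : ℝ}
    (hC : ∀ z, L z ≤ C * (1 + ∑ k, |z k|)) :
    Integrable (fun z => Real.exp (L z)) (gaussPi κ) := by
  refine ((integrable_exp_mul_sum_abs C).const_mul (Real.exp C)).mono'
    (by fun_prop) (Filter.Eventually.of_forall fun z => ?_)
  rw [Real.norm_of_nonneg (Real.exp_pos _).le, ← Real.exp_add]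
  exact Real.exp_le_exp.2 ((hC z).trans_eq (by ring))

theorem abs_dotProduct_le_sum_abs (a z : κ → ℝ) :
    |a ⬝ᵥ z| ≤ (∑ k, |a k|) * ∑ k, |z k| := by
  rw [dotProduct, Finset.sum_mul]
  refine (Finset.abs_sum_le_sum_abs _ _).trans (Finset.sum_le_sum fun k _ => ?_)
  rw [abs_mul]
  exact mul_le_mul_of_nonneg_left
    (Finset.single_le_sum (f := fun k => |z k|) (fun _ _ => abs_nonneg _) (Finset.mem_univ k))
    (abs_nonneg _)

theorem integral_gaussPi_sum (f : (κ → ℝ) → ℝ) (g : (κ' → ℝ) → ℝ) :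
    ∫ z, f (fun k => z (Sum.inl k)) * g (fun k => z (Sum.inr k)) ∂gaussPi (κ ⊕ κ') =
      (∫ z, f z ∂gaussPi κ) * ∫ z, g z ∂gaussPi κ' := by
  have h := measurePreserving_sumPiEquivProdPi (X := fun _ : κ ⊕ κ' => ℝ)
    (fun _ => gaussianReal 0 1)
  rw [← integral_prod_mul f g, ← h.integral_comp (MeasurableEquiv.measurableEmbedding _)]
  rfl

end GaussPi

/-! ### Exponential moments of the norm of a Gaussian vector. -/

section Chi

variable {κ ι : Type*} [Fintype κ] [Fintype ι]

/-- The regularized Euclidean norm `√(ε + ∑ ⟨eᵢ, z⟩²)` of the coordinates of `z` along `e`. -/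
noncomputable def smoothNorm (ε : ℝ) (e : ι → κ → ℝ) (z : κ → ℝ) : ℝ :=
  √(ε + ∑ i, (e i ⬝ᵥ z) ^ 2)

variable {ε : ℝ} {e : ι → κ → ℝ}

theorem continuous_smoothNorm : Continuous (smoothNorm ε e) := by
  unfold smoothNorm dotProduct
  fun_prop

theorem sq_smoothNorm (hε : 0 ≤ ε) (z : κ → ℝ) :
    smoothNorm ε e z ^ 2 = ε + ∑ i, (e i ⬝ᵥ z) ^ 2 :=
  Real.sq_sqrt (by positivity)

theorem smoothNorm_pos (hε : 0 < ε) (z : κ → ℝ) : 0 < smoothNorm ε e z :=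
  Real.sqrt_pos.2 (by positivity)

theorem abs_dotProduct_le_smoothNorm (hε : 0 ≤ ε) (i : ι) (z : κ → ℝ) :
    |e i ⬝ᵥ z| ≤ smoothNorm ε e z := by
  refine Real.abs_le_sqrt ?_
  have := Finset.single_le_sum (f := fun i => (e i ⬝ᵥ z) ^ 2) (fun _ _ => sq_nonneg _)
    (Finset.mem_univ i)
  linarith

theorem smoothNorm_le (ε : ℝ) (e : ι → κ → ℝ) : ∃ C, 0 ≤ C ∧
    ∀ z, smoothNorm ε e z ≤ C * (1 + ∑ k, |z k|) := by
  refine ⟨√|ε| + ∑ i, ∑ k, |e i k|, by positivity, fun z => ?_⟩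
  have h1 : smoothNorm ε e z ≤ √|ε| + ∑ i, |e i ⬝ᵥ z| := by
    refine Real.sqrt_le_iff.2 ⟨by positivity, ?_⟩
    have h2 : ∑ i, (e i ⬝ᵥ z) ^ 2 ≤ (∑ i, |e i ⬝ᵥ z|) ^ 2 := by
      refine le_of_eq_of_le ?_
        (Finset.sum_sq_le_sq_sum_of_nonneg fun i _ => abs_nonneg (e i ⬝ᵥ z))
      simp
    have h3 : √|ε| ^ 2 = |ε| := Real.sq_sqrt (abs_nonneg _)
    have h4 : 0 ≤ √|ε| * ∑ i, |e i ⬝ᵥ z| := by positivity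
    nlinarith [le_abs_self ε]
  have h5 : ∑ i, |e i ⬝ᵥ z| ≤ (∑ i, ∑ k, |e i k|) * ∑ k, |z k| := by
    rw [Finset.sum_mul]
    exact Finset.sum_le_sum fun i _ => abs_dotProduct_le_sum_abs _ _
  have h6 : 0 ≤ √|ε| * ∑ k, |z k| := by positivity
  have h7 : 0 ≤ ∑ i, ∑ k, |e i k| := by positivity
  linarith

theorem integrable_exp_mul_smoothNorm (c ε : ℝ) (e : ι → κ → ℝ) :
    Integrable (fun z => Real.exp (c * smoothNorm ε e z)) (gaussPi κ) := by
  obtain ⟨C, hC0, hC⟩ := smoothNorm_le ε e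
  refine integrable_exp_gaussPi_of_le (C := |c| * C)
    (continuous_smoothNorm.const_mul c) fun z => ?_
  have h0 : 0 ≤ smoothNorm ε e z := Real.sqrt_nonneg _
  calc c * smoothNorm ε e z ≤ |c| * smoothNorm ε e z :=
        mul_le_mul_of_nonneg_right (le_abs_self c) h0
    _ ≤ |c| * (C * (1 + ∑ k, |z k|)) := mul_le_mul_of_nonneg_left (hC z) (abs_nonneg c)
    _ = _ := by ring

theorem mem_interior_integrableExpSet_smoothNorm (c ε : ℝ) (e : ι → κ → ℝ) :
    c ∈ interior (integrableExpSet (smoothNorm ε e) (gaussPi κ)) := by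
  have : integrableExpSet (smoothNorm ε e) (gaussPi κ) = Set.univ :=
    Set.eq_univ_of_forall fun c => integrable_exp_mul_smoothNorm c ε e
  rw [this, interior_univ]
  trivial

theorem integrable_smoothNorm_pow_mul_exp (n : ℕ) (c ε : ℝ) (e : ι → κ → ℝ) :
    Integrable (fun z => smoothNorm ε e z ^ n * Real.exp (c * smoothNorm ε e z)) (gaussPi κ) :=
  integrable_pow_mul_exp_of_mem_interior_integrableExpSet
    (mem_interior_integrableExpSet_smoothNorm c ε e) n

/-- By orthonormality, moving along `e i` changes only the `i`-th coordinate; ε > 0 keeps the square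
root away from its singularity. -/
theorem hasLineDerivAt_smoothNorm [DecidableEq ι] (hε : 0 < ε)
    (he : ∀ i j, e i ⬝ᵥ e j = if i = j then 1 else 0) (i : ι) (z : κ → ℝ) :
    HasLineDerivAt ℝ (smoothNorm ε e) ((e i ⬝ᵥ z) / smoothNorm ε e z) z (e i) := by
  have hq : ∀ t : ℝ, ∑ j, (e j ⬝ᵥ (z + t • e i)) ^ 2 =
      (∑ j, (e j ⬝ᵥ z) ^ 2) + t * (2 * (e i ⬝ᵥ z)) + t ^ 2 := by
    intro t
    have : ∀ j, (e j ⬝ᵥ (z + t • e i)) ^ 2 =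
        (e j ⬝ᵥ z) ^ 2 + if j = i then t * (2 * (e i ⬝ᵥ z)) + t ^ 2 else 0 := by
      intro j
      rw [dotProduct_add, dotProduct_smul, he]
      split_ifs with h
      · subst h; simp; ring
      · simp
    simp_rw [this, Finset.sum_add_distrib]
    simp; ring
  unfold HasLineDerivAt
  have hd : HasDerivAt (fun t : ℝ => ε + ∑ j, (e j ⬝ᵥ (z + t • e i)) ^ 2)
      (2 * (e i ⬝ᵥ z)) 0 := by
    simp_rw [hq]
    have h := ((((hasDerivAt_id (0 : ℝ)).mul_const (2 * (e i ⬝ᵥ z))).const_add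
      (∑ j, (e j ⬝ᵥ z) ^ 2)).add (hasDerivAt_pow 2 (0 : ℝ))).const_add ε
    convert! h using 1
    simp
  have hne : ε + ∑ j, (e j ⬝ᵥ (z + (0 : ℝ) • e i)) ^ 2 ≠ 0 := by positivity
  convert! hd.sqrt hne using 1
  simp only [zero_smul, add_zero, smoothNorm]
  rw [mul_div_mul_left _ _ two_ne_zero]

/-- Stein's identity for yᵢ · (yᵢ exp(cR)), with yᵢ = ⟨eᵢ, z⟩, gives E exp(cR) + c E (yᵢ²/R)
exp(cR). Sum over i and use Σ yᵢ² = R² - ε ≤ R². -/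
theorem integral_sq_dotProduct_mul_exp_le [DecidableEq ι] (hε : 0 < ε)
    (he : ∀ i j, e i ⬝ᵥ e j = if i = j then 1 else 0) {c : ℝ} (hc : 0 ≤ c) :
    ∫ z, smoothNorm ε e z ^ 2 * Real.exp (c * smoothNorm ε e z) ∂gaussPi κ ≤
      (Fintype.card ι + ε) * (∫ z, Real.exp (c * smoothNorm ε e z) ∂gaussPi κ) +
        c * ∫ z, smoothNorm ε e z * Real.exp (c * smoothNorm ε e z) ∂gaussPi κ := by
  set R := smoothNorm ε e with hR
  have hRpos : ∀ z, 0 < R z := smoothNorm_pos hε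
  have hcont : Continuous R := continuous_smoothNorm
  have hec : ∀ i, Continuous fun z => e i ⬝ᵥ z := fun i => by unfold dotProduct; fun_prop
  have hi0 : Integrable (fun z => Real.exp (c * R z)) (gaussPi κ) :=
    integrable_exp_mul_smoothNorm c ε e
  have hi1 : Integrable (fun z => R z * Real.exp (c * R z)) (gaussPi κ) := by
    simpa using integrable_smoothNorm_pow_mul_exp 1 c ε e
  have hi2 : Integrable (fun z => R z ^ 2 * Real.exp (c * R z)) (gaussPi κ) :=
    integrable_smoothNorm_pow_mul_exp 2 c ε e
  have habs : ∀ i z, |e i ⬝ᵥ z| ≤ R z := fun i z => abs_dotProduct_le_smoothNorm hε.le i z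
  have hsq : ∀ i z, (e i ⬝ᵥ z) ^ 2 ≤ R z ^ 2 := fun i z =>
    sq_le_sq.2 ((habs i z).trans (le_abs_self _))
  have hiq : ∀ i, Integrable (fun z => (e i ⬝ᵥ z) * ((e i ⬝ᵥ z) * Real.exp (c * R z)))
      (gaussPi κ) := fun i => by
    refine hi2.mono' (by fun_prop) (Filter.Eventually.of_forall fun z => ?_)
    rw [← mul_assoc, ← sq, Real.norm_of_nonneg (by positivity)]
    exact mul_le_mul_of_nonneg_right (hsq i z) (Real.exp_pos _).le
  have hid : ∀ i, Integrable (fun z => (e i ⬝ᵥ z) ^ 2 / R z * Real.exp (c * R z))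
      (gaussPi κ) := fun i => by
    refine hi1.mono' 
      (((((hec i).pow 2).div hcont fun z => (hRpos z).ne').mul (by fun_prop)).aestronglyMeasurable)
      (Filter.Eventually.of_forall fun z => ?_)
    have := hRpos z
    rw [Real.norm_of_nonneg (by positivity)]
    refine mul_le_mul_of_nonneg_right ?_ (Real.exp_pos _).le
    rw [div_le_iff₀ this, ← sq]
    exact hsq i z
  have hstein : ∀ i, ∫ z, (e i ⬝ᵥ z) * ((e i ⬝ᵥ z) * Real.exp (c * R z)) ∂gaussPi κ =
      (∫ z, Real.exp (c * R z) ∂gaussPi κ) +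
        c * ∫ z, (e i ⬝ᵥ z) ^ 2 / R z * Real.exp (c * R z) ∂gaussPi κ := by
    intro i
    rw [integral_dotProduct_mul_gaussPi
      (F' := fun z => Real.exp (c * R z) + c * ((e i ⬝ᵥ z) ^ 2 / R z * Real.exp (c * R z)))
      ?_ ?_ (hi0.add ((hid i).const_mul c)) (hiq i),
      integral_add hi0 ((hid i).const_mul c), integral_const_mul]
    · intro z
      have h1 : HasDerivAt (fun t : ℝ => e i ⬝ᵥ (z + t • e i)) 1 0 := by
        have : (fun t : ℝ => e i ⬝ᵥ (z + t • e i)) = fun t => (e i ⬝ᵥ z) + t := by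
          ext t; rw [dotProduct_add, dotProduct_smul, he]; simp
        rw [this]
        exact (hasDerivAt_id 0).const_add _
      have h2 := ((hasLineDerivAt_smoothNorm hε he i z).const_mul c).exp
      unfold HasLineDerivAt at *
      convert! h1.mul h2 using 1
      simp only [zero_smul, add_zero, ← hR]
      ring
    · refine hi1.mono' (by fun_prop) (Filter.Eventually.of_forall fun z => ?_)
      rw [norm_mul, Real.norm_eq_abs, Real.norm_of_nonneg (Real.exp_pos _).le]
      exact mul_le_mul_of_nonneg_right (habs i z) (Real.exp_pos _).le
  have hsum1 : ∫ z, R z ^ 2 * Real.exp (c * R z) ∂gaussPi κ =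
      ε * (∫ z, Real.exp (c * R z) ∂gaussPi κ) +
        ∑ i, ∫ z, (e i ⬝ᵥ z) * ((e i ⬝ᵥ z) * Real.exp (c * R z)) ∂gaussPi κ := by
    rw [← integral_finsetSum _ fun i _ => hiq i, ← integral_const_mul,
      ← integral_add (hi0.const_mul ε) (integrable_finsetSum _ fun i _ => hiq i)]
    congr 1
    ext z
    rw [hR, sq_smoothNorm hε.le, add_mul, Finset.sum_mul]
    congr 1
    exact Finset.sum_congr rfl fun i _ => by ring
  have hsum2 : ∑ i, ∫ z, (e i ⬝ᵥ z) ^ 2 / R z * Real.exp (c * R z) ∂gaussPi κ ≤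
      ∫ z, R z * Real.exp (c * R z) ∂gaussPi κ := by
    rw [← integral_finsetSum _ fun i _ => hid i]
    refine integral_mono (integrable_finsetSum _ fun i _ => hid i) hi1 fun z => ?_
    rw [← Finset.sum_mul, ← Finset.sum_div]
    refine mul_le_mul_of_nonneg_right ?_ (Real.exp_pos _).le
    rw [div_le_iff₀ (hRpos z), ← sq, hR, sq_smoothNorm hε.le]
    linarith
  rw [hsum1]
  simp_rw [hstein, Finset.sum_add_distrib, ← Finset.mul_sum]
  simp only [Finset.sum_const, Finset.card_univ, nsmul_eq_mul]
  have := mul_le_mul_of_nonneg_left hsum2 hc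
  linarith

/-- With s = √(k + ε) and k the number of coordinates, the second-moment bound yields M' ≤ (s + c) M
for the moment generating function M; integrate from M(0) = 1. -/
theorem integral_exp_mul_smoothNorm_le [DecidableEq ι] (hε : 0 < ε)
    (he : ∀ i j, e i ⬝ᵥ e j = if i = j then 1 else 0) {c : ℝ} (hc : 0 ≤ c) :
    ∫ z, Real.exp (c * smoothNorm ε e z) ∂gaussPi κ ≤
      Real.exp (c * √(Fintype.card ι + ε) + c ^ 2 / 2) := by
  set s := √(Fintype.card ι + ε) with hs
  have hs2 : s ^ 2 = Fintype.card ι + ε := Real.sq_sqrt (by positivity)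
  have hs0 : 0 < s := Real.sqrt_pos.2 (by positivity)
  set M : ℝ → ℝ := mgf (smoothNorm ε e) (gaussPi κ) with hM
  set D : ℝ → ℝ := fun c => ∫ z, smoothNorm ε e z * Real.exp (c * smoothNorm ε e z) ∂gaussPi κ
  have hMd : ∀ c, HasDerivAt M (D c) c := fun c =>
    hasDerivAt_mgf (mem_interior_integrableExpSet_smoothNorm c ε e)
  have hDM : ∀ c, 0 ≤ c → D c ≤ (s + c) * M c := by
    intro c hc
    have hi0 := integrable_exp_mul_smoothNorm c ε e
    have hi1 : Integrable (fun z => smoothNorm ε e z * Real.exp (c * smoothNorm ε e z))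
        (gaussPi κ) := by
      simpa using integrable_smoothNorm_pow_mul_exp 1 c ε e
    have hi2 := integrable_smoothNorm_pow_mul_exp 2 c ε e
    have h1 := integral_sq_dotProduct_mul_exp_le hε he hc
    -- Integrate (R - (s + c))² ≥ 0 against exp(cR), to pass from the second moment to the first.
    have h2 : 2 * (s + c) * D c ≤
        (∫ z, smoothNorm ε e z ^ 2 * Real.exp (c * smoothNorm ε e z) ∂gaussPi κ) +
          (s + c) ^ 2 * M c := by
      simp only [D, hM, mgf]
      rw [← integral_const_mul, ← integral_const_mul, ← integral_add hi2 (hi0.const_mul _)]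
      refine integral_mono (hi1.const_mul _) (hi2.add (hi0.const_mul _)) fun z => ?_
      have := mul_nonneg (sq_nonneg (smoothNorm ε e z - (s + c)))
        (Real.exp_pos (c * smoothNorm ε e z)).le
      simp only
      linarith
    rw [← hs2] at h1
    -- The two bounds give (2s² + 2sc + c²) M on the right, which is smaller than the claim by scM ≥
    -- 0.
    have h3 : (2 * s + c) * D c ≤ (2 * s + c) * ((s + c) * M c) := by
      change _ ≤ s ^ 2 * M c + c * D c at h1
      have hMc : 0 ≤ s * c * M c := mul_nonneg (mul_nonneg hs0.le hc) mgf_nonneg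
      linarith
    exact le_of_mul_le_mul_left h3 (by positivity)
  have hanti : AntitoneOn (fun c => M c * Real.exp (-(c * s + c ^ 2 / 2))) (Set.Ici 0) := by
    have hder : ∀ c, HasDerivAt (fun c => M c * Real.exp (-(c * s + c ^ 2 / 2)))
        ((D c - (s + c) * M c) * Real.exp (-(c * s + c ^ 2 / 2))) c := by
      intro c
      have h := (hMd c).mul ((((hasDerivAt_id c).mul_const s).add
        ((hasDerivAt_pow 2 c).div_const 2)).neg.exp)
      convert! h using 1
      simp; ring
    refine antitoneOn_of_deriv_nonpos (convex_Ici 0)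
      (fun c _ => (hder c).continuousAt.continuousWithinAt)
      (fun c _ => (hder c).differentiableAt.differentiableWithinAt) fun c hc' => ?_
    rw [(hder c).deriv]
    rw [interior_Ici] at hc'
    exact mul_nonpos_of_nonpos_of_nonneg (by linarith [hDM c (le_of_lt hc')]) (Real.exp_pos _).le
  have h := hanti (Set.mem_Ici.2 le_rfl) (Set.mem_Ici.2 hc) hc
  have hM0 : M 0 = 1 := by simp [hM]
  simp only [hM0, Real.exp_neg] at h
  norm_num at h
  rwa [← div_eq_mul_inv, div_le_one (Real.exp_pos _)] at h

/-- The exponential moments of the Euclidean norm of a standard Gaussian vector. -/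
theorem integral_exp_mul_sqrt_sum_sq_le [DecidableEq ι]
    (he : ∀ i j, e i ⬝ᵥ e j = if i = j then 1 else 0) {c : ℝ} (hc : 0 ≤ c) :
    ∫ z, Real.exp (c * smoothNorm 0 e z) ∂gaussPi κ ≤
      Real.exp (c * √(Fintype.card ι) + c ^ 2 / 2) := by
  -- The regularized norm dominates the norm for every ε > 0, so only the right-hand side needs the
  -- limit ε → 0.
  have hlim : Filter.Tendsto (fun ε : ℝ => Real.exp (c * √(Fintype.card ι + ε) + c ^ 2 / 2))
      (nhdsWithin 0 (Set.Ioi 0)) (nhds (Real.exp (c * √(Fintype.card ι) + c ^ 2 / 2))) := by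
    have : Continuous fun ε : ℝ => Real.exp (c * √(Fintype.card ι + ε) + c ^ 2 / 2) := by fun_prop
    simpa using (this.tendsto 0).mono_left nhdsWithin_le_nhds
  refine ge_of_tendsto hlim (eventually_mem_nhdsWithin.mono fun ε hε => ?_)
  refine le_trans (integral_mono (integrable_exp_mul_smoothNorm c 0 e)
    (integrable_exp_mul_smoothNorm c ε e) fun z => ?_) (integral_exp_mul_smoothNorm_le hε he hc)
  refine Real.exp_le_exp.2 (mul_le_mul_of_nonneg_left (Real.sqrt_le_sqrt ?_) hc)
  have : 0 < ε := hε
  linarith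

end Chi

/-! ### Slepian's comparison by Gaussian interpolation. -/

section Slepian

variable {κ ι : Type*} [Fintype κ] [Fintype ι]

/-- The partition function `∑ exp (β ⟨cᵢ, z⟩)`. -/
noncomputable def partitionSum (β : ℝ) (c : ι → κ → ℝ) (z : κ → ℝ) : ℝ :=
  ∑ i, Real.exp (β * (c i ⬝ᵥ z))

variable {β l : ℝ}

theorem partitionSum_pos [Nonempty ι] (c : ι → κ → ℝ) (z : κ → ℝ) : 0 < partitionSum β c z :=
  Finset.sum_pos (fun _ _ => Real.exp_pos _) Finset.univ_nonempty

theorem exp_le_partitionSum (c : ι → κ → ℝ) (z : κ → ℝ) (i : ι) :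
    Real.exp (β * (c i ⬝ᵥ z)) ≤ partitionSum β c z :=
  Finset.single_le_sum (f := fun i => Real.exp (β * (c i ⬝ᵥ z)))
    (fun _ _ => (Real.exp_pos _).le) (Finset.mem_univ i)

/-- The power l/β of the partition function is a smooth substitute for exp(l max): the price is
card^(l/β), which tends to 1 as β → ∞. -/
theorem partitionSum_rpow_le [Nonempty ι] (hβ : 0 < β) (hl : 0 ≤ l) {c : ι → κ → ℝ} {z : κ → ℝ}
    {B : ℝ} (hB : ∀ i, c i ⬝ᵥ z ≤ B) :
    partitionSum β c z ^ (l / β) ≤ (Fintype.card ι : ℝ) ^ (l / β) * Real.exp (l * B) := by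
  have h1 : partitionSum β c z ≤ Fintype.card ι * Real.exp (β * B) := by
    refine (Finset.sum_le_card_nsmul _ _ (Real.exp (β * B)) fun i _ => ?_).trans_eq (by simp)
    exact Real.exp_le_exp.2 (mul_le_mul_of_nonneg_left (hB i) hβ.le)
  refine (Real.rpow_le_rpow (partitionSum_pos c z).le h1 (by positivity)).trans_eq ?_
  rw [Real.mul_rpow (by positivity) (Real.exp_pos _).le, ← Real.exp_mul]
  congr 2
  field_simp

theorem continuous_partitionSum (c : ι → κ → ℝ) : Continuous (partitionSum β c) := by
  unfold partitionSum dotProduct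
  fun_prop

theorem hasDerivAt_partitionSum {c : ℝ → ι → κ → ℝ} {z : ℝ → κ → ℝ} {y' : ι → ℝ}
    {t : ℝ} (h : ∀ i, HasDerivAt (fun t => c t i ⬝ᵥ z t) (y' i) t) :
    HasDerivAt (fun t => partitionSum β (c t) (z t))
      (∑ i, β * y' i * Real.exp (β * (c t i ⬝ᵥ z t))) t := by
  unfold partitionSum
  refine HasDerivAt.fun_sum fun i _ => ?_
  convert! ((h i).const_mul β).exp using 1
  ring

/-- The weight `exp (β ⟨cᵢ, z⟩) S ^ (α - 1)`, where `S` is the partition function. -/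
noncomputable def gibbsWeight (β α : ℝ) (c : ι → κ → ℝ) (i : ι) (z : κ → ℝ) : ℝ :=
  Real.exp (β * (c i ⬝ᵥ z)) * partitionSum β c z ^ (α - 1)

theorem gibbsWeight_nonneg [Nonempty ι] {α : ℝ} (c : ι → κ → ℝ) (i : ι) (z : κ → ℝ) :
    0 ≤ gibbsWeight β α c i z :=
  mul_nonneg (Real.exp_pos _).le (Real.rpow_nonneg (partitionSum_pos c z).le _)

theorem gibbsWeight_le [Nonempty ι] {α : ℝ} (c : ι → κ → ℝ) (i : ι) (z : κ → ℝ) :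
    gibbsWeight β α c i z ≤ partitionSum β c z ^ α := by
  have hS := partitionSum_pos (β := β) c z
  calc gibbsWeight β α c i z ≤ partitionSum β c z * partitionSum β c z ^ (α - 1) :=
        mul_le_mul_of_nonneg_right (exp_le_partitionSum c z i) (Real.rpow_nonneg hS.le _)
    _ = partitionSum β c z ^ α := by
        rw [mul_comm, ← Real.rpow_add_one hS.ne', sub_add_cancel]

theorem continuous_gibbsWeight [Nonempty ι] {α : ℝ} (c : ι → κ → ℝ) (i : ι) :
    Continuous (gibbsWeight β α c i) := by
  unfold gibbsWeight
  refine Continuous.mul (by unfold dotProduct; fun_prop)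
    ((continuous_partitionSum c).rpow_const fun z => Or.inl (partitionSum_pos c z).ne')

/-- The derivative of `gibbsWeight` in the direction `v`. -/
noncomputable def gibbsWeightDeriv (β α : ℝ) (c : ι → κ → ℝ) (i : ι) (v z : κ → ℝ) : ℝ :=
  β * (c i ⬝ᵥ v) * gibbsWeight β α c i z +
    (α - 1) * β * ∑ j, (c j ⬝ᵥ v) *
      (gibbsWeight β α c i z * (Real.exp (β * (c j ⬝ᵥ z)) / partitionSum β c z))

theorem hasLineDerivAt_gibbsWeight [Nonempty ι] {α : ℝ} (c : ι → κ → ℝ) (i : ι) (v z : κ → ℝ) :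
    HasLineDerivAt ℝ (gibbsWeight β α c i) (gibbsWeightDeriv β α c i v z) z v := by
  have hy : ∀ j, HasDerivAt (fun t : ℝ => c j ⬝ᵥ (z + t • v)) (c j ⬝ᵥ v) 0 := fun j => by
    simp_rw [dotProduct_add, dotProduct_smul, smul_eq_mul]
    simpa using ((hasDerivAt_id (0 : ℝ)).mul_const (c j ⬝ᵥ v)).const_add (c j ⬝ᵥ z)
  have hS := partitionSum_pos (β := β) c z
  unfold HasLineDerivAt gibbsWeight
  have h1 := ((hy i).const_mul β).exp
  have h2 := (hasDerivAt_partitionSum (β := β) (c := fun _ => c)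
    (z := fun t : ℝ => z + t • v) hy).rpow_const (p := α - 1)
    (Or.inl (partitionSum_pos c _).ne')
  convert! h1.mul h2 using 1
  simp only [gibbsWeightDeriv, gibbsWeight, zero_smul, add_zero]
  rw [Real.rpow_sub_one hS.ne' (α - 1)]
  simp only [Finset.mul_sum, Finset.sum_mul]
  congr 1
  · ring
  · exact Finset.sum_congr rfl fun j _ => by ring

theorem continuous_gibbsWeightDeriv [Nonempty ι] {α : ℝ} (c : ι → κ → ℝ) (i : ι) (v : κ → ℝ) :
    Continuous (gibbsWeightDeriv β α c i v) := by
  have h1 := continuous_gibbsWeight (β := β) (α := α) c i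
  have h2 := continuous_partitionSum (β := β) c
  have h3 : ∀ z, partitionSum β c z ≠ 0 := fun z => (partitionSum_pos c z).ne'
  have h4 : ∀ j, Continuous fun z => Real.exp (β * (c j ⬝ᵥ z)) := fun j => by
    unfold dotProduct; fun_prop
  unfold gibbsWeightDeriv
  fun_prop (disch := assumption)

/-- The sign behind Slepian's inequality: equal variances kill the diagonal term, and each remaining
term is a product of the nonpositive factors α - 1 and ⟨cⱼ, v⟩ with nonnegative ones. -/
theorem gibbsWeightDeriv_nonneg [Nonempty ι] {α : ℝ} (hβ : 0 ≤ β) (hα : α ≤ 1)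
    {c : ι → κ → ℝ} {i : ι} {v : κ → ℝ} (hi : c i ⬝ᵥ v = 0) (hj : ∀ j, c j ⬝ᵥ v ≤ 0)
    (z : κ → ℝ) : 0 ≤ gibbsWeightDeriv β α c i v z := by
  rw [gibbsWeightDeriv, hi, mul_zero, zero_mul, zero_add]
  refine mul_nonneg_of_nonpos_of_nonpos
    (mul_nonpos_of_nonpos_of_nonneg (by linarith) hβ) (Finset.sum_nonpos fun j _ => ?_)
  exact mul_nonpos_of_nonpos_of_nonneg (hj j) (mul_nonneg (gibbsWeight_nonneg c i z)
    (div_nonneg (Real.exp_pos _).le (partitionSum_pos c z).le))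

theorem abs_gibbsWeightDeriv_le [Nonempty ι] {α : ℝ} (c : ι → κ → ℝ) (i : ι) (v z : κ → ℝ) :
    |gibbsWeightDeriv β α c i v z| ≤
      (|β * (c i ⬝ᵥ v)| + |(α - 1) * β| * ∑ j, |c j ⬝ᵥ v|) * gibbsWeight β α c i z := by
  have hw := gibbsWeight_nonneg (β := β) (α := α) c i z
  rw [gibbsWeightDeriv, add_mul, mul_assoc |_|, Finset.sum_mul]
  refine (abs_add_le _ _).trans (add_le_add ?_ ?_)
  · rw [abs_mul, abs_of_nonneg hw]
  · rw [abs_mul]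
    refine mul_le_mul_of_nonneg_left ?_ (abs_nonneg _)
    refine (Finset.abs_sum_le_sum_abs _ _).trans (Finset.sum_le_sum fun j _ => ?_)
    rw [abs_mul]
    refine mul_le_mul_of_nonneg_left ?_ (abs_nonneg _)
    have h0 := partitionSum_pos (β := β) c z
    rw [abs_of_nonneg (by positivity)]
    exact mul_le_of_le_one_right hw ((div_le_one h0).2 (exp_le_partitionSum c z j))

theorem partitionSum_rpow_integrable [Nonempty ι] (hβ : 0 < β) (hl : 0 ≤ l) (c : ι → κ → ℝ) :
    Integrable (fun z => partitionSum β c z ^ (l / β)) (gaussPi κ) := by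
  refine (((integrable_exp_mul_sum_abs (l * ∑ i, ∑ k, |c i k|)).const_mul
    ((Fintype.card ι : ℝ) ^ (l / β)))).mono'
    (((continuous_partitionSum c).rpow_const
      fun z => Or.inl (partitionSum_pos c z).ne').aestronglyMeasurable)
    (Filter.Eventually.of_forall fun z => ?_)
  rw [Real.norm_of_nonneg (Real.rpow_nonneg (partitionSum_pos c z).le _), mul_assoc l]
  refine partitionSum_rpow_le hβ hl fun i => (le_abs_self _).trans
    ((abs_dotProduct_le_sum_abs _ _).trans (mul_le_mul_of_nonneg_right ?_ (by positivity)))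
  exact Finset.single_le_sum (f := fun i => ∑ k, |c i k|)
    (fun _ _ => by positivity) (Finset.mem_univ i)

/-- The Gaussian interpolation `cos t • aᵢ + sin t • bᵢ`. -/
noncomputable def interpolation (a b : ι → κ → ℝ) (t : ℝ) (i : ι) : κ → ℝ :=
  Real.cos t • a i + Real.sin t • b i

/-- The velocity of `interpolation`. -/
noncomputable def interpolationDeriv (a b : ι → κ → ℝ) (t : ℝ) (i : ι) : κ → ℝ :=
  -Real.sin t • a i + Real.cos t • b i

theorem hasDerivAt_interpolation {ι : Type*} (a b : ι → κ → ℝ) (t : ℝ) (i : ι) (z : κ → ℝ) :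
    HasDerivAt (fun t => interpolation a b t i ⬝ᵥ z) (interpolationDeriv a b t i ⬝ᵥ z) t := by
  simp only [interpolation, interpolationDeriv, add_dotProduct, smul_dotProduct, smul_eq_mul]
  exact ((Real.hasDerivAt_cos t).mul_const _).add ((Real.hasDerivAt_sin t).mul_const _)

/-- A common bound for `|⟨aᵢ, z⟩|` and `|⟨bᵢ, z⟩|`, and for the interpolations between them. -/
noncomputable def dotBound (a b : ι → κ → ℝ) (z : κ → ℝ) : ℝ :=
  ∑ i, (|a i ⬝ᵥ z| + |b i ⬝ᵥ z|)

theorem abs_combination_dotProduct_le (a b : ι → κ → ℝ) {x y : ℝ} (hx : |x| ≤ 1) (hy : |y| ≤ 1)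
    (i : ι) (z : κ → ℝ) : |(x • a i + y • b i) ⬝ᵥ z| ≤ dotBound a b z := by
  refine le_trans ?_ (Finset.single_le_sum (f := fun i => |a i ⬝ᵥ z| + |b i ⬝ᵥ z|)
    (fun _ _ => by positivity) (Finset.mem_univ i))
  rw [add_dotProduct, smul_dotProduct, smul_dotProduct, smul_eq_mul, smul_eq_mul]
  refine (abs_add_le _ _).trans ?_
  rw [abs_mul, abs_mul]
  exact add_le_add (mul_le_of_le_one_left (abs_nonneg _) hx)
    (mul_le_of_le_one_left (abs_nonneg _) hy)

theorem integrable_exp_mul_dotBound (a b : ι → κ → ℝ) {c : ℝ} (hc : 0 ≤ c) :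
    Integrable (fun z => Real.exp (c * dotBound a b z)) (gaussPi κ) := by
  refine integrable_exp_gaussPi_of_le (C := c * ∑ i, ((∑ k, |a i k|) + ∑ k, |b i k|))
    (by unfold dotBound dotProduct; fun_prop) fun z => ?_
  rw [mul_assoc]
  refine mul_le_mul_of_nonneg_left ?_ hc
  rw [dotBound, Finset.sum_mul]
  refine Finset.sum_le_sum fun i _ => ?_
  have h1 := abs_dotProduct_le_sum_abs (a i) z
  have h2 := abs_dotProduct_le_sum_abs (b i) z
  have h3 : 0 ≤ ∑ k, |a i k| := by positivity
  have h4 : 0 ≤ ∑ k, |b i k| := by positivity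
  linarith

theorem hasDerivAt_integral_interpolation [Nonempty ι] (hβ : 0 < β) (hl : 0 ≤ l)
    (a b : ι → κ → ℝ) (t : ℝ) :
    HasDerivAt (fun t => ∫ z, partitionSum β (interpolation a b t) z ^ (l / β) ∂gaussPi κ)
      (∫ z, ∑ i, l * ((interpolationDeriv a b t i ⬝ᵥ z) *
        gibbsWeight β (l / β) (interpolation a b t) i z) ∂gaussPi κ) t := by
  set N : ℝ := (Fintype.card ι : ℝ)
  have hB0 : ∀ z, 0 ≤ dotBound a b z := fun z => Finset.sum_nonneg fun i _ => by positivity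
  have hw : ∀ t i z, gibbsWeight β (l / β) (interpolation a b t) i z ≤
      N ^ (l / β) * Real.exp (l * dotBound a b z) := fun t i z =>
    (gibbsWeight_le _ i z).trans (partitionSum_rpow_le hβ hl fun i => (le_abs_self _).trans
      (abs_combination_dotProduct_le a b (Real.abs_cos_le_one t) (Real.abs_sin_le_one t) i z))
  refine (hasDerivAt_integral_of_dominated_loc_of_deriv_le (s := Set.univ)
    (F := fun t z => partitionSum β (interpolation a b t) z ^ (l / β))
    (F' := fun t z => ∑ i, l * ((interpolationDeriv a b t i ⬝ᵥ z) *
        gibbsWeight β (l / β) (interpolation a b t) i z))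
    -- Uniform in t: with D = `dotBound a b z`, each weight is at most N^(l/β) exp(lD), and each
    -- velocity term at most D ≤ exp(D).
    (bound := fun z => N * (l * N ^ (l / β)) * Real.exp ((1 + l) * dotBound a b z))
    Filter.univ_mem
    (Filter.Eventually.of_forall fun t => (partitionSum_rpow_integrable hβ hl _).1)
    (partitionSum_rpow_integrable hβ hl _) ?_ ?_
    ((integrable_exp_mul_dotBound a b (by positivity)).const_mul _) ?_).2
  · refine Continuous.aestronglyMeasurable ?_
    refine continuous_finsetSum _ fun i _ => continuous_const.mul
      (Continuous.mul (by unfold dotProduct; fun_prop) (continuous_gibbsWeight _ i))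
  · refine Filter.Eventually.of_forall fun z t _ => ?_
    rw [Real.norm_eq_abs]
    refine (Finset.abs_sum_le_sum_abs _ _).trans ((Finset.sum_le_card_nsmul _ _
      (l * N ^ (l / β) * Real.exp ((1 + l) * dotBound a b z)) fun i _ => ?_).trans_eq ?_)
    · rw [abs_mul, abs_mul, abs_of_nonneg hl, abs_of_nonneg (gibbsWeight_nonneg _ i z), mul_assoc l]
      refine mul_le_mul_of_nonneg_left ?_ hl
      have h1 : |interpolationDeriv a b t i ⬝ᵥ z| ≤ Real.exp (dotBound a b z) :=
        (abs_combination_dotProduct_le a b (by rw [abs_neg]; exact Real.abs_sin_le_one t)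
          (Real.abs_cos_le_one t) i z).trans
          ((by linarith : dotBound a b z ≤ dotBound a b z + 1).trans (Real.add_one_le_exp _))
      refine (mul_le_mul h1 (hw t i z) (gibbsWeight_nonneg _ i z) (Real.exp_pos _).le).trans_eq ?_
      rw [mul_left_comm, ← Real.exp_add]
      ring_nf
    · simp only [Finset.card_univ, nsmul_eq_mul, N]; ring
  · refine Filter.Eventually.of_forall fun z t _ => ?_
    have h := (hasDerivAt_partitionSum (β := β) (c := interpolation a b) (z := fun _ => z)
      (fun i => hasDerivAt_interpolation a b t i z)).rpow_const (p := l / β)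
      (Or.inl (partitionSum_pos _ z).ne')
    convert! h using 1
    rw [Finset.sum_mul, Finset.sum_mul]
    refine Finset.sum_congr rfl fun i _ => ?_
    rw [gibbsWeight]
    field_simp

/-- **Slepian's comparison inequality** for powers of partition functions. -/
theorem integral_partitionSum_rpow_le_of_dotProduct_le [Nonempty ι] (hβ : 0 < β) (hl : 0 ≤ l)
    (hlβ : l ≤ β) {a b : ι → κ → ℝ} (hab : ∀ i j, a i ⬝ᵥ b j = 0)
    (hdiag : ∀ i, a i ⬝ᵥ a i = b i ⬝ᵥ b i) (hcov : ∀ i j, b i ⬝ᵥ b j ≤ a i ⬝ᵥ a j) :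
    ∫ z, partitionSum β a z ^ (l / β) ∂gaussPi κ ≤
      ∫ z, partitionSum β b z ^ (l / β) ∂gaussPi κ := by
  have hα : l / β ≤ 1 := (div_le_one hβ).2 hlβ
  -- Orthogonality of the two families (independence of the processes) removes the cross terms and
  -- leaves the difference of covariances.
  have hdot : ∀ t i j, interpolation a b t j ⬝ᵥ interpolationDeriv a b t i =
      Real.sin t * Real.cos t * (b j ⬝ᵥ b i - a j ⬝ᵥ a i) := by
    intro t i j
    simp only [interpolation, interpolationDeriv, add_dotProduct, dotProduct_add,
      smul_dotProduct, dotProduct_smul, smul_eq_mul, hab, dotProduct_comm (b j) (a i)]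
    ring
  have hgi : ∀ t i, Integrable (gibbsWeight β (l / β) (interpolation a b t) i) (gaussPi κ) :=
    fun t i => (partitionSum_rpow_integrable hβ hl (interpolation a b t)).mono'
      (continuous_gibbsWeight _ i).aestronglyMeasurable (Filter.Eventually.of_forall fun z => by
        rw [Real.norm_of_nonneg (gibbsWeight_nonneg _ i z)]
        exact gibbsWeight_le _ i z)
  have hgdi : ∀ t i v, Integrable (gibbsWeightDeriv β (l / β) (interpolation a b t) i v)
      (gaussPi κ) := fun t i v => ((hgi t i).const_mul _).mono'
        (continuous_gibbsWeightDeriv _ i v).aestronglyMeasurable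
        (Filter.Eventually.of_forall fun z => abs_gibbsWeightDeriv_le _ i v z)
  have hvg : ∀ t i, Integrable (fun z => (interpolationDeriv a b t i ⬝ᵥ z) *
      gibbsWeight β (l / β) (interpolation a b t) i z) (gaussPi κ) := by
    intro t i
    refine (((integrable_exp_mul_dotBound a b (c := 1 + l) (by positivity)).const_mul
      ((Fintype.card ι : ℝ) ^ (l / β)))).mono' (Continuous.aestronglyMeasurable
        (Continuous.mul (by unfold dotProduct; fun_prop) (continuous_gibbsWeight _ i)))
      (Filter.Eventually.of_forall fun z => ?_)
    rw [norm_mul, Real.norm_eq_abs, Real.norm_of_nonneg (gibbsWeight_nonneg _ i z)]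
    have h1 : |interpolationDeriv a b t i ⬝ᵥ z| ≤ Real.exp (dotBound a b z) :=
      (abs_combination_dotProduct_le a b (by rw [abs_neg]; exact Real.abs_sin_le_one t)
        (Real.abs_cos_le_one t) i z).trans
        ((by linarith : dotBound a b z ≤ dotBound a b z + 1).trans (Real.add_one_le_exp _))
    have h2 := (gibbsWeight_le (interpolation a b t) i z).trans
      (partitionSum_rpow_le hβ hl fun i => (le_abs_self _).trans (abs_combination_dotProduct_le a b
        (Real.abs_cos_le_one t) (Real.abs_sin_le_one t) i z))
    refine (mul_le_mul h1 h2 (gibbsWeight_nonneg _ i z) (Real.exp_pos _).le).trans_eq ?_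
    rw [mul_left_comm, ← Real.exp_add]
    ring_nf
  -- On this interval sin t cos t ≥ 0, so after Stein's identity every summand of the derivative is
  -- nonnegative.
  have hmono : MonotoneOn
      (fun t => ∫ z, partitionSum β (interpolation a b t) z ^ (l / β) ∂gaussPi κ)
      (Set.Icc 0 (Real.pi / 2)) := by
    have hd := hasDerivAt_integral_interpolation hβ hl a b
    refine monotoneOn_of_deriv_nonneg (convex_Icc _ _)
      (fun t _ => (hd t).continuousAt.continuousWithinAt)
      (fun t _ => (hd t).differentiableAt.differentiableWithinAt) fun t ht => ?_
    rw [interior_Icc] at ht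
    have hs : 0 ≤ Real.sin t := Real.sin_nonneg_of_nonneg_of_le_pi ht.1.le
      (ht.2.le.trans (by linarith [Real.pi_pos]))
    have hc : 0 ≤ Real.cos t := Real.cos_nonneg_of_neg_pi_div_two_le_of_le
      (by linarith [ht.1, Real.pi_pos]) ht.2.le
    rw [(hd t).deriv, integral_finsetSum _ fun i _ => (hvg t i).const_mul l]
    refine Finset.sum_nonneg fun i _ => ?_
    rw [integral_const_mul, integral_dotProduct_mul_gaussPi
      (fun z => hasLineDerivAt_gibbsWeight _ i _ z) (hgi t i) (hgdi t i _) (hvg t i)]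
    refine mul_nonneg hl (integral_nonneg fun z => gibbsWeightDeriv_nonneg hβ.le hα ?_ ?_ z)
    · rw [hdot, hdiag]; ring
    · intro j
      rw [hdot]
      exact mul_nonpos_of_nonneg_of_nonpos (mul_nonneg hs hc) (by linarith [hcov j i])
  have h := hmono (Set.left_mem_Icc.2 (by positivity)) (Set.right_mem_Icc.2 (by positivity))
    (by positivity)
  have h0 : interpolation a b 0 = a := by ext; simp [interpolation]
  have h1 : interpolation a b (Real.pi / 2) = b := by ext; simp [interpolation]
  simpa only [h0, h1] using h

/-- **Slepian's comparison inequality** for the exponential moments of suprema. -/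
theorem integral_exp_mul_le_of_dotProduct_le [Nonempty ι] (hl : 0 ≤ l)
    {a b : ι → κ → ℝ} (hab : ∀ i j, a i ⬝ᵥ b j = 0)
    (hdiag : ∀ i, a i ⬝ᵥ a i = b i ⬝ᵥ b i) (hcov : ∀ i j, b i ⬝ᵥ b j ≤ a i ⬝ᵥ a j)
    {f g : (κ → ℝ) → ℝ} (hf : ∀ z, ∃ i, f z ≤ a i ⬝ᵥ z) (hg : ∀ z i, b i ⬝ᵥ z ≤ g z)
    (hfi : Integrable (fun z => Real.exp (l * f z)) (gaussPi κ))
    (hgi : Integrable (fun z => Real.exp (l * g z)) (gaussPi κ)) :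
    ∫ z, Real.exp (l * f z) ∂gaussPi κ ≤ ∫ z, Real.exp (l * g z) ∂gaussPi κ := by
  set G := ∫ z, Real.exp (l * g z) ∂gaussPi κ
  have hN : (0 : ℝ) < Fintype.card ι := by exact_mod_cast Fintype.card_pos
  have hlim : Filter.Tendsto (fun β : ℝ => (Fintype.card ι : ℝ) ^ (l / β) * G) Filter.atTop
      (nhds G) := by
    have h1 : Filter.Tendsto (fun β : ℝ => l / β) Filter.atTop (nhds 0) :=
      Filter.Tendsto.div_atTop tendsto_const_nhds Filter.tendsto_id
    have h2 := ((Real.continuousAt_const_rpow hN.ne' (b := 0)).tendsto.comp h1).mul_const G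
    simpa using h2
  -- β ≥ l makes the exponent l/β at most 1, as the sign argument requires; β ≥ 1 keeps β positive
  -- even when l = 0.
  refine ge_of_tendsto hlim ((Filter.eventually_ge_atTop (max l 1)).mono fun β hβ' => ?_)
  have hlβ : l ≤ β := (le_max_left _ _).trans hβ'
  have hβ : 0 < β := zero_lt_one.trans_le ((le_max_right _ _).trans hβ')
  calc ∫ z, Real.exp (l * f z) ∂gaussPi κ
      ≤ ∫ z, partitionSum β a z ^ (l / β) ∂gaussPi κ := by
        refine integral_mono hfi (partitionSum_rpow_integrable hβ hl a) fun z => ?_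
        obtain ⟨i, hi⟩ := hf z
        calc Real.exp (l * f z) ≤ Real.exp (β * (a i ⬝ᵥ z)) ^ (l / β) := by
              rw [← Real.exp_mul]
              refine Real.exp_le_exp.2 ((mul_le_mul_of_nonneg_left hi hl).trans_eq ?_)
              field_simp
          _ ≤ _ := Real.rpow_le_rpow (Real.exp_pos _).le (exp_le_partitionSum a z i)
              (by positivity)
    _ ≤ ∫ z, partitionSum β b z ^ (l / β) ∂gaussPi κ :=
        integral_partitionSum_rpow_le_of_dotProduct_le hβ hl hlβ hab hdiag hcov
    _ ≤ ∫ z, (Fintype.card ι : ℝ) ^ (l / β) * Real.exp (l * g z) ∂gaussPi κ :=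
        integral_mono (partitionSum_rpow_integrable hβ hl b) (hgi.const_mul _)
          fun z => partitionSum_rpow_le hβ hl (hg z)
    _ = _ := integral_const_mul _ _

end Slepian

/-! ### Chevet's inequality and the tail of a restricted Gaussian matrix. -/

section Chevet

variable {μ ν ι q : Type*} [Fintype μ] [Fintype ν] [Fintype ι] [Fintype q]

/-- The tensor product of two vectors. -/
def tensorVec (x : μ → ℝ) (v : ν → ℝ) : μ × ν → ℝ := fun p => x p.1 * v p.2

theorem tensorVec_dotProduct_tensorVec (x x' : μ → ℝ) (v v' : ν → ℝ) :
    tensorVec x v ⬝ᵥ tensorVec x' v' = (x ⬝ᵥ x') * (v ⬝ᵥ v') := by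
  simp only [dotProduct, tensorVec, Fintype.sum_prod_type, Finset.sum_mul_sum]
  exact Finset.sum_congr rfl fun i _ => Finset.sum_congr rfl fun j _ => by ring

theorem dotProduct_le_one_of_dotProduct_self {x y : μ → ℝ} (hx : x ⬝ᵥ x = 1) (hy : y ⬝ᵥ y = 1) :
    x ⬝ᵥ y ≤ 1 := by
  have h : 0 ≤ (x - y) ⬝ᵥ (x - y) := Finset.sum_nonneg fun i _ => mul_self_nonneg _
  simp only [sub_dotProduct, dotProduct_sub, hx, hy, dotProduct_comm y x] at h
  linarith

theorem dotProduct_le_smoothNorm_single [DecidableEq ν] {v : ν → ℝ} (hv : v ⬝ᵥ v = 1)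
    (h : ν → ℝ) : v ⬝ᵥ h ≤ smoothNorm 0 (fun i : ν => Pi.single i (1 : ℝ)) h := by
  refine Real.le_sqrt_of_sq_le ?_
  have := Finset.sum_mul_sq_le_sq_mul_sq Finset.univ v h
  simp only [dotProduct] at hv
  simp only [← sq] at hv
  rw [hv, one_mul] at this
  simp only [zero_add, single_one_dotProduct]
  exact this

theorem integral_exp_mul_gaussPi_unit (l : ℝ) :
    ∫ z, Real.exp (l * z ()) ∂gaussPi Unit = Real.exp (l ^ 2 / 2) := by
  have h := integral_fintype_prod_eq_prod (μ := fun _ : Unit => gaussianReal 0 1)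
    (fun (_ : Unit) (x : ℝ) => Real.exp (l * x))
  simp only [Finset.univ_unique, Finset.prod_singleton] at h
  have h2 := congrFun (mgf_id_gaussianReal (μ := 0) (v := 1)) l
  simp only [mgf, id] at h2
  refine h.trans (h2.trans (by simp))

/-- **Chevet's inequality** for the exponential moments of a Gaussian matrix restricted to finitely
many pairs of unit vectors. -/
theorem integral_exp_sup_tensorVec_le [Nonempty ι] [DecidableEq q] [DecidableEq ν]
    {e : q → μ → ℝ}
    (he : ∀ i j, e i ⬝ᵥ e j = if i = j then 1 else 0) {x : ι → μ → ℝ} {v : ι → ν → ℝ}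
    (hx : ∀ i, x i ⬝ᵥ x i = 1) (hv : ∀ i, v i ⬝ᵥ v i = 1)
    (hxe : ∀ i g, x i ⬝ᵥ g ≤ smoothNorm 0 e g) {l : ℝ} (hl : 0 ≤ l) :
    Integrable (fun z => Real.exp (l * Finset.univ.sup' Finset.univ_nonempty
      fun i => tensorVec (x i) (v i) ⬝ᵥ z)) (gaussPi (μ × ν)) ∧
    ∫ z, Real.exp (l * Finset.univ.sup' Finset.univ_nonempty
      fun i => tensorVec (x i) (v i) ⬝ᵥ z) ∂gaussPi (μ × ν) ≤
      Real.exp (l * (√(Fintype.card ν) + √(Fintype.card q)) + l ^ 2 / 2) := by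
  set h : (μ × ν → ℝ) → ℝ := fun z => Finset.univ.sup' Finset.univ_nonempty
      fun i => tensorVec (x i) (v i) ⬝ᵥ z with hh
  have hhc : Continuous h := Continuous.finset_sup'_apply _ fun i _ => by
    unfold dotProduct; fun_prop
  have hex : ∀ z, ∃ i, h z = tensorVec (x i) (v i) ⬝ᵥ z := fun z => by
    obtain ⟨i, _, hi⟩ := Finset.exists_mem_eq_sup' Finset.univ_nonempty
      fun i => tensorVec (x i) (v i) ⬝ᵥ z
    exact ⟨i, hi⟩
  have hhi : Integrable (fun z => Real.exp (l * h z)) (gaussPi (μ × ν)) := by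
    set a := fun i => tensorVec (x i) (v i)
    refine (integrable_exp_mul_dotBound a a hl).mono' (by fun_prop)
      (Filter.Eventually.of_forall fun z => ?_)
    rw [Real.norm_of_nonneg (Real.exp_pos _).le]
    obtain ⟨i, hi⟩ := hex z
    refine Real.exp_le_exp.2 (mul_le_mul_of_nonneg_left ?_ hl)
    have := abs_combination_dotProduct_le a a (x := 1) (y := 0) (by simp) (by simp) i z
    rw [one_smul, zero_smul, add_zero] at this
    exact hi.le.trans ((le_abs_self _).trans this)
  refine ⟨hhi, ?_⟩
  -- Both processes live on one Gaussian space, in disjoint blocks of coordinates. The constant 1 on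
  -- `Unit` is the auxiliary normal variable that raises the variance of `a` from 1 to 2, that of
  -- `b`.
  let a : ι → ((μ × ν) ⊕ Unit) ⊕ (μ ⊕ ν) → ℝ := fun i =>
    Sum.elim (Sum.elim (tensorVec (x i) (v i)) fun _ => 1) 0
  let b : ι → ((μ × ν) ⊕ Unit) ⊕ (μ ⊕ ν) → ℝ := fun i => Sum.elim 0 (Sum.elim (x i) (v i))
  let s : ν → ν → ℝ := fun i => Pi.single i 1
  have hs : ∀ i j, s i ⬝ᵥ s j = if i = j then 1 else 0 := fun i j => by
    simp [s, Pi.single_apply, eq_comm]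
  let f : (((μ × ν) ⊕ Unit) ⊕ (μ ⊕ ν) → ℝ) → ℝ := fun z =>
    h (fun k => z (Sum.inl (Sum.inl k))) + z (Sum.inl (Sum.inr ()))
  let g : (((μ × ν) ⊕ Unit) ⊕ (μ ⊕ ν) → ℝ) → ℝ := fun z =>
    smoothNorm 0 e (fun k => z (Sum.inr (Sum.inl k))) +
      smoothNorm 0 s (fun k => z (Sum.inr (Sum.inr k)))
  have haz : ∀ i z, a i ⬝ᵥ z = tensorVec (x i) (v i) ⬝ᵥ (fun k => z (Sum.inl (Sum.inl k))) +
      z (Sum.inl (Sum.inr ())) := fun i z => by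
    simp [a, dotProduct, Fintype.sum_sum_type]
  have hbz : ∀ i z, b i ⬝ᵥ z = x i ⬝ᵥ (fun k => z (Sum.inr (Sum.inl k))) +
      v i ⬝ᵥ (fun k => z (Sum.inr (Sum.inr k))) := fun i z => by
    simp [b, dotProduct, Fintype.sum_sum_type]
  have hfi : Integrable (fun z => Real.exp (l * f z)) (gaussPi _) := by
    refine (integrable_exp_mul_dotBound a a hl).mono'
      (Continuous.aestronglyMeasurable (by fun_prop)) (Filter.Eventually.of_forall fun z => ?_)
    rw [Real.norm_of_nonneg (Real.exp_pos _).le]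
    obtain ⟨i, hi⟩ := hex fun k => z (Sum.inl (Sum.inl k))
    refine Real.exp_le_exp.2 (mul_le_mul_of_nonneg_left ?_ hl)
    have := abs_combination_dotProduct_le a a (x := 1) (y := 0) (by simp) (by simp) i z
    rw [one_smul, zero_smul, add_zero, haz, ← hi] at this
    exact (le_abs_self _).trans this
  have hgi : Integrable (fun z => Real.exp (l * g z)) (gaussPi _) := by
    obtain ⟨C₁, hC₁, hC₁'⟩ := smoothNorm_le 0 e
    obtain ⟨C₂, hC₂, hC₂'⟩ := smoothNorm_le 0 s
    have hc1 : Continuous (smoothNorm 0 e) := continuous_smoothNorm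
    have hc2 : Continuous (smoothNorm 0 s) := continuous_smoothNorm
    refine integrable_exp_gaussPi_of_le (C := l * (C₁ + C₂)) (by fun_prop) fun z => ?_
    rw [mul_assoc]
    refine mul_le_mul_of_nonneg_left ?_ hl
    rw [add_mul]
    refine add_le_add ((hC₁' _).trans (mul_le_mul_of_nonneg_left ?_ hC₁))
      ((hC₂' _).trans (mul_le_mul_of_nonneg_left ?_ hC₂))
    all_goals
      simp only [Fintype.sum_sum_type, add_le_add_iff_left]
    · have h1 : 0 ≤ ∑ k, |z (Sum.inl (Sum.inl k))| := by positivity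
      have h2 : 0 ≤ ∑ k, |z (Sum.inl (Sum.inr k))| := by positivity
      have h3 : 0 ≤ ∑ k, |z (Sum.inr (Sum.inr k))| := by positivity
      linarith
    · have h1 : 0 ≤ ∑ k, |z (Sum.inl (Sum.inl k))| := by positivity
      have h2 : 0 ≤ ∑ k, |z (Sum.inl (Sum.inr k))| := by positivity
      have h3 : 0 ≤ ∑ k, |z (Sum.inr (Sum.inl k))| := by positivity
      linarith
  have haa : ∀ i j, a i ⬝ᵥ a j = (x i ⬝ᵥ x j) * (v i ⬝ᵥ v j) + 1 := fun i j => by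
    rw [haz, ← tensorVec_dotProduct_tensorVec]; rfl
  have hbb : ∀ i j, b i ⬝ᵥ b j = x i ⬝ᵥ x j + v i ⬝ᵥ v j := fun i j => by
    rw [hbz]; rfl
  have key := integral_exp_mul_le_of_dotProduct_le (a := a) (b := b) (f := f) (g := g) hl
    (fun i j => by rw [haz]; simp [b, ← Pi.zero_def]) (fun i => by
      rw [haa, hbb, hx, hv, one_mul]) (fun i j => by
      rw [haa, hbb]
      have h1 := dotProduct_le_one_of_dotProduct_self (hx i) (hx j)
      have h2 := dotProduct_le_one_of_dotProduct_self (hv i) (hv j)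
      -- The covariance gap is (1 - ⟨xᵢ, xⱼ⟩)(1 - ⟨vᵢ, vⱼ⟩).
      nlinarith [mul_nonneg (sub_nonneg.2 h1) (sub_nonneg.2 h2)])
    (fun z => by
      obtain ⟨i, hi⟩ := hex fun k => z (Sum.inl (Sum.inl k))
      exact ⟨i, by rw [haz, ← hi]⟩)
    (fun z i => by
      rw [hbz]
      exact add_le_add (hxe i _) (dotProduct_le_smoothNorm_single (hv i) _)) hfi hgi
  have hf : ∫ z, Real.exp (l * f z) ∂gaussPi _ =
      (∫ z, Real.exp (l * h z) ∂gaussPi _) * Real.exp (l ^ 2 / 2) := by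
    have h1 := integral_gaussPi_sum (κ := (μ × ν) ⊕ Unit) (κ' := μ ⊕ ν)
      (fun z => Real.exp (l * h (fun k => z (Sum.inl k))) * Real.exp (l * z (Sum.inr ())))
      (fun _ => 1)
    have h2 := integral_gaussPi_sum (κ := μ × ν) (κ' := Unit)
      (fun z => Real.exp (l * h z)) (fun z => Real.exp (l * z ()))
    rw [integral_exp_mul_gaussPi_unit] at h2
    rw [h2] at h1
    simp only [mul_one, integral_const, probReal_univ, smul_eq_mul] at h1
    rw [← h1]
    simp only [f, mul_add, Real.exp_add]
  have hg : ∫ z, Real.exp (l * g z) ∂gaussPi _ =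
      (∫ z, Real.exp (l * smoothNorm 0 e z) ∂gaussPi _) *
        ∫ z, Real.exp (l * smoothNorm 0 s z) ∂gaussPi _ := by
    have h1 := integral_gaussPi_sum (κ := (μ × ν) ⊕ Unit) (κ' := μ ⊕ ν) (fun _ => 1)
      (fun z => Real.exp (l * smoothNorm 0 e (fun k => z (Sum.inl k))) *
        Real.exp (l * smoothNorm 0 s (fun k => z (Sum.inr k))))
    have h2 := integral_gaussPi_sum (κ := μ) (κ' := ν)
      (fun z => Real.exp (l * smoothNorm 0 e z)) (fun z => Real.exp (l * smoothNorm 0 s z))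
    rw [h2] at h1
    simp only [one_mul, integral_const, probReal_univ, smul_eq_mul] at h1
    rw [← h1]
    simp only [g, mul_add, Real.exp_add]
  rw [hf, hg] at key
  have h3 := mul_le_mul (integral_exp_mul_sqrt_sum_sq_le he hl)
    (integral_exp_mul_sqrt_sum_sq_le hs hl) (integral_nonneg fun _ => (Real.exp_pos _).le)
    (Real.exp_pos _).le
  have h4 := key.trans h3
  -- The two norms contribute l²/2 each; the auxiliary variable takes one of them back.
  rw [← le_div_iff₀ (Real.exp_pos _), ← Real.exp_add, ← Real.exp_sub] at h4
  refine h4.trans_eq ?_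
  congr 1
  ring

/-- Chernoff's bound at parameter l: with r the sum of the two square roots, the exponent is -l(r +
l) + lr + l²/2 = -l²/2. -/
theorem gaussPi_real_exists_lt_le [DecidableEq q] [DecidableEq ν]
    {e : q → μ → ℝ} (he : ∀ i j, e i ⬝ᵥ e j = if i = j then 1 else 0) {x : ι → μ → ℝ}
    {v : ι → ν → ℝ} (hx : ∀ i, x i ⬝ᵥ x i = 1) (hv : ∀ i, v i ⬝ᵥ v i = 1)
    (hxe : ∀ i g, x i ⬝ᵥ g ≤ smoothNorm 0 e g) {l : ℝ} (hl : 0 ≤ l) :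
    (gaussPi (μ × ν)).real {z | ∃ i, √(Fintype.card ν) + √(Fintype.card q) + l <
      tensorVec (x i) (v i) ⬝ᵥ z} ≤ Real.exp (-(l ^ 2 / 2)) := by
  rcases isEmpty_or_nonempty ι with hι | hι
  · simpa using (Real.exp_pos _).le
  obtain ⟨hi, hle⟩ := integral_exp_sup_tensorVec_le he hx hv hxe hl
  set r := √(Fintype.card ν) + √(Fintype.card q)
  have h1 := measure_ge_le_exp_mul_mgf (r + l) hl hi
  refine le_trans (measureReal_mono ?_) (h1.trans ((mul_le_mul_of_nonneg_left hle
    (Real.exp_pos _).le).trans_eq ?_))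
  · rintro z ⟨i, hz⟩
    exact hz.le.trans (Finset.le_sup' (fun i => tensorVec (x i) (v i) ⬝ᵥ z) (Finset.mem_univ i))
  · rw [← Real.exp_add]
    congr 1
    ring

/-- The tail bound for the norm of a standard Gaussian matrix restricted to the unit vectors of the
span of an orthonormal family. -/
theorem gaussPi_real_exists_mem_lt_le [DecidableEq q] [DecidableEq ν]
    {e : q → μ → ℝ} (he : ∀ i j, e i ⬝ᵥ e j = if i = j then 1 else 0) {W : Set (μ → ℝ)}
    (hW : ∀ x ∈ W, x ⬝ᵥ x = 1) (hWe : ∀ x ∈ W, ∀ g, x ⬝ᵥ g ≤ smoothNorm 0 e g)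
    {l : ℝ} (hl : 0 ≤ l) :
    (gaussPi (μ × ν)).real {z | ∃ x ∈ W, ∃ v : ν → ℝ, v ⬝ᵥ v = 1 ∧
      √(Fintype.card ν) + √(Fintype.card q) + l < tensorVec x v ⬝ᵥ z} ≤
      Real.exp (-(l ^ 2 / 2)) := by
  set r := √(Fintype.card ν) + √(Fintype.card q) + l
  let K : Set ((μ → ℝ) × (ν → ℝ)) := {p | p.1 ∈ W ∧ p.2 ⬝ᵥ p.2 = 1}
  rcases K.eq_empty_or_nonempty with hK | hK
  · have : {z | ∃ x ∈ W, ∃ v : ν → ℝ, v ⬝ᵥ v = 1 ∧ r < tensorVec x v ⬝ᵥ z} = ∅ := by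
      refine Set.eq_empty_of_forall_notMem ?_
      rintro z ⟨x, hx, v, hv, -⟩
      exact hK.subset (show (x, v) ∈ K from ⟨hx, hv⟩)
    rw [this, measureReal_empty]
    exact (Real.exp_pos _).le
  have := hK.to_subtype
  -- The finite bound does not depend on the number of pairs, so it passes to the increasing union
  -- over initial segments of a dense sequence.
  let d : ℕ → K := TopologicalSpace.denseSeq K
  let U : ℕ → Set (μ × ν → ℝ) := fun N =>
    {z | ∃ i : Fin N, r < tensorVec (d i).1.1 (d i).1.2 ⬝ᵥ z}
  have hU : Monotone U := fun N M hNM z ⟨i, hi⟩ => ⟨Fin.castLE hNM i, hi⟩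
  have hUle : ∀ N, gaussPi (μ × ν) (U N) ≤ ENNReal.ofReal (Real.exp (-(l ^ 2 / 2))) := by
    intro N
    rw [← ofReal_measureReal]
    exact ENNReal.ofReal_le_ofReal (gaussPi_real_exists_lt_le (ι := Fin N) he
      (fun i => hW _ (d i).2.1) (fun i => (d i).2.2) (fun i => hWe _ (d i).2.1) hl)
  have hsub : {z | ∃ x ∈ W, ∃ v : ν → ℝ, v ⬝ᵥ v = 1 ∧ r < tensorVec x v ⬝ᵥ z} ⊆ ⋃ N, U N := by
    rintro z ⟨x, hx, v, hv, hz⟩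
    by_contra hcon
    have hall : ∀ k, tensorVec (d k).1.1 (d k).1.2 ⬝ᵥ z ≤ r := by
      intro k
      by_contra hk
      exact hcon (Set.mem_iUnion.2 ⟨k + 1, ⟨⟨k, k.lt_succ_self⟩, not_le.1 hk⟩⟩)
    -- A non-strict bound on the dense sequence extends to all pairs by continuity; hence the strict
    -- inequality in the event.
    have hclosed : IsClosed {p : K | tensorVec p.1.1 p.1.2 ⬝ᵥ z ≤ r} :=
      isClosed_le (by unfold tensorVec dotProduct; fun_prop) continuous_const
    have h := (TopologicalSpace.denseRange_denseSeq K).induction_on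
      (p := fun p : K => tensorVec p.1.1 p.1.2 ⬝ᵥ z ≤ r) ⟨(x, v), hx, hv⟩ hclosed hall
    exact absurd hz (not_lt.2 h)
  refine ENNReal.toReal_le_of_le_ofReal (Real.exp_pos _).le ((measure_mono hsub).trans ?_)
  rw [hU.measure_iUnion]
  exact iSup_le hUle

end Chevet

/-! ### Singular values through the eigenbasis of T*T. -/

section SingularValues

open Module InnerProductSpace

variable {V F : Type*} [NormedAddCommGroup V] [InnerProductSpace ℝ V] [FiniteDimensional ℝ V]
  [NormedAddCommGroup F] [InnerProductSpace ℝ F] [FiniteDimensional ℝ F]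

/-- ‖T b‖² = ⟨b, T*T b⟩ is the eigenvalue at the unit eigenvector b, that is, the squared singular
value. -/
theorem norm_apply_eigenvectorBasis_adjoint_comp_self (T : V →ₗ[ℝ] F) {n : ℕ}
    (hn : finrank ℝ V = n) (k : Fin n) :
    ‖T (T.isSymmetric_adjoint_comp_self.eigenvectorBasis hn k)‖ = T.singularValues k := by
  rw [← sq_eq_sq₀ (norm_nonneg _) (T.singularValues_nonneg k), T.sq_singularValues_fin hn,
    ← real_inner_self_eq_norm_sq, ← LinearMap.adjoint_inner_right, ← LinearMap.comp_apply,
    LinearMap.IsSymmetric.apply_eigenvectorBasis, inner_smul_right, real_inner_self_eq_norm_sq,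
    OrthonormalBasis.norm_eq_one]
  simp

theorem norm_apply_le_singularValues_zero_mul (T : V →ₗ[ℝ] F) (w : V) :
    ‖T w‖ ≤ T.singularValues 0 * ‖w‖ := by
  set b := T.isSymmetric_adjoint_comp_self.eigenvectorBasis rfl
  have h0 := T.singularValues_nonneg 0
  rw [← sq_le_sq₀ (norm_nonneg _) (by positivity), mul_pow, ← real_inner_self_eq_norm_sq,
    ← LinearMap.adjoint_inner_right, ← b.sum_inner_mul_inner, ← b.sum_sq_inner_right,
    Finset.mul_sum]
  refine Finset.sum_le_sum fun k _ => ?_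
  rw [← LinearMap.comp_apply, ← T.isSymmetric_adjoint_comp_self (b k) w,
    LinearMap.IsSymmetric.apply_eigenvectorBasis, real_inner_smul_left, real_inner_comm w,
    ← T.sq_singularValues_fin rfl k]
  have h1 : T.singularValues k ^ 2 ≤ T.singularValues 0 ^ 2 :=
    pow_le_pow_left₀ (T.singularValues_nonneg k) (T.singularValues_antitone (Nat.zero_le _)) 2
  simp only [RCLike.ofReal_real_eq_id, id]
  nlinarith [mul_le_mul_of_nonneg_right h1 (sq_nonneg (inner ℝ (b k) w))]

end SingularValues

/-! ### Nuclear norm duality and the deterministic oracle inequality. -/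

variable {m n p : ℕ}

/-- Both sides are the trace of MᵀN, which does not depend on the orthonormal basis. -/
theorem sum_mul_eq_sum_inner (M N : Matrix (Fin m) (Fin n) ℝ) {ι : Type} [Fintype ι]
    (b : OrthonormalBasis ι ℝ (EuclideanSpace ℝ (Fin n))) :
    ∑ i, ∑ j, M i j * N i j =
      ∑ k, inner ℝ (Matrix.toEuclideanLin M (b k)) (Matrix.toEuclideanLin N (b k)) := by
  have h : ∀ {ι : Type} [Fintype ι] (b : OrthonormalBasis ι ℝ (EuclideanSpace ℝ (Fin n))),
      ∑ k, inner ℝ (Matrix.toEuclideanLin M (b k)) (Matrix.toEuclideanLin N (b k)) =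
        LinearMap.trace ℝ _ (LinearMap.adjoint (Matrix.toEuclideanLin M) ∘ₗ
          Matrix.toEuclideanLin N) := by
    intro ι _ b
    rw [LinearMap.trace_eq_sum_inner _ b]
    simp [LinearMap.adjoint_inner_right]
  rw [h b, ← h (EuclideanSpace.basisFun (Fin n) ℝ), Finset.sum_comm]
  refine Finset.sum_congr rfl fun j _ => ?_
  simp [EuclideanSpace.inner_eq_star_dotProduct, dotProduct, Matrix.toLpLin_apply, mul_comm]

theorem frobenius_norm_sq (M : Matrix (Fin m) (Fin n) ℝ) : ‖M‖ ^ 2 = ∑ i, ∑ j, M i j * M i j := by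
  rw [Matrix.frobenius_norm_def, ← Real.sqrt_eq_rpow, Real.sq_sqrt (by positivity)]
  simp [sq]

theorem nuclearNorm_eq_sum (C : Matrix (Fin p) (Fin n) ℝ) :
    nuclearNorm C = ∑ k : Fin n, (Matrix.toEuclideanLin C).singularValues k := by
  rw [Fin.sum_univ_eq_sum_range fun k => (Matrix.toEuclideanLin C).singularValues k]
  -- The added indices are at least p, hence at least the rank, where singular values vanish.
  refine Finset.sum_subset (Finset.range_mono (min_le_right _ _)) fun k hk hk' => ?_
  rw [singularValues, LinearMap.singularValues_eq_zero_iff_le_finrank_range]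
  have h := Submodule.finrank_le (LinearMap.range (Matrix.toEuclideanLin C))
  rw [finrank_euclideanSpace_fin] at h
  simp only [Finset.mem_range] at hk hk'
  omega

/-- In the basis bₖ of right singular vectors of C, the k-th term is ⟨E bₖ, X C bₖ⟩, at most s‖X C
bₖ‖ ≤ s d₁(X)‖C bₖ‖, and ‖C bₖ‖ is the k-th singular value. -/
theorem abs_sum_mul_le_nuclearNorm {X : Matrix (Fin m) (Fin p) ℝ} {E : Matrix (Fin m) (Fin n) ℝ}
    {s : ℝ} (hs : 0 ≤ s)
    (hE : ∀ w v, |inner ℝ (Matrix.toEuclideanLin E v) (Matrix.toEuclideanLin X w)| ≤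
      s * ‖Matrix.toEuclideanLin X w‖ * ‖v‖) (C : Matrix (Fin p) (Fin n) ℝ) :
    |∑ i, ∑ j, E i j * (X * C) i j| ≤ largestSingularValue X * s * nuclearNorm C := by
  set T := Matrix.toEuclideanLin C
  set b := T.isSymmetric_adjoint_comp_self.eigenvectorBasis finrank_euclideanSpace_fin
  rw [sum_mul_eq_sum_inner E (X * C) b, nuclearNorm_eq_sum, Finset.mul_sum]
  refine (Finset.abs_sum_le_sum_abs _ _).trans (Finset.sum_le_sum fun k _ => ?_)
  have hmul : Matrix.toEuclideanLin (X * C) (b k) = Matrix.toEuclideanLin X (T (b k)) := by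
    simp [T, Matrix.toLpLin_apply]
  rw [hmul]
  refine (hE (T (b k)) (b k)).trans ?_
  rw [b.norm_eq_one, mul_one]
  have h := norm_apply_le_singularValues_zero_mul (Matrix.toEuclideanLin X) (T (b k))
  rw [norm_apply_eigenvectorBasis_adjoint_comp_self T finrank_euclideanSpace_fin k] at h
  refine (mul_le_mul_of_nonneg_left h hs).trans_eq ?_
  rw [largestSingularValue, singularValues]
  ring

/-- Expand the squares around XA and use minimality against B. The noise term of `Atilde` cancels
against its penalty; that of B adds 2τ‖B‖₁ to the 2τ‖B‖₁ already there. -/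
theorem oracle_inequality_of_abs_sum_mul_le {X : Matrix (Fin m) (Fin p) ℝ}
    {A : Matrix (Fin p) (Fin n) ℝ} {E : Matrix (Fin m) (Fin n) ℝ} {τ : ℝ}
    (hE : ∀ C : Matrix (Fin p) (Fin n) ℝ, |∑ i, ∑ j, E i j * (X * C) i j| ≤ τ * nuclearNorm C)
    {Atilde : Matrix (Fin p) (Fin n) ℝ} (h : IsNNPEstimator X (X * A + E) τ Atilde)
    (B : Matrix (Fin p) (Fin n) ℝ) :
    ‖X * Atilde - X * A‖ ^ 2 ≤ ‖X * B - X * A‖ ^ 2 + 4 * τ * nuclearNorm B := by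
  have hexp : ∀ C : Matrix (Fin p) (Fin n) ℝ, ‖X * A + E - X * C‖ ^ 2 =
      ‖X * C - X * A‖ ^ 2 - 2 * (∑ i, ∑ j, E i j * (X * C) i j) +
        (2 * (∑ i, ∑ j, E i j * (X * A) i j) + ‖E‖ ^ 2) := by
    intro C
    simp only [frobenius_norm_sq, Finset.mul_sum, ← Finset.sum_add_distrib,
      ← Finset.sum_sub_distrib]
    refine Finset.sum_congr rfl fun i _ => Finset.sum_congr rfl fun j _ => ?_
    simp only [Matrix.sub_apply, Matrix.add_apply]
    ring
  have h1 := h B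
  rw [nnpCriterion, nnpCriterion, hexp, hexp] at h1
  have h2 := abs_le.1 (hE Atilde)
  have h3 := abs_le.1 (hE B)
  linarith [h2.1, h2.2, h3.1, h3.2]

/-! ### Restriction of the noise to the column space of X. -/

/-- The Euclidean unit sphere of the column space of `X`. -/
def columnSphere {m p : ℕ} (X : Matrix (Fin m) (Fin p) ℝ) : Set (Fin m → ℝ) :=
  {x | x ⬝ᵥ x = 1 ∧ ∃ w, X *ᵥ w = x}

/-- An orthonormal basis of the column space together with Cauchy-Schwarz in its coordinates. Its
cardinality is the rank, which is why √q rather than √m enters τ. -/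
theorem exists_orthonormal_columnSphere {m p : ℕ} (X : Matrix (Fin m) (Fin p) ℝ) :
    ∃ e : Fin X.rank → Fin m → ℝ, (∀ i j, e i ⬝ᵥ e j = if i = j then 1 else 0) ∧
      ∀ x ∈ columnSphere X, ∀ g, x ⬝ᵥ g ≤ smoothNorm 0 e g := by
  set R := LinearMap.range (Matrix.toEuclideanLin X)
  have hR : Module.finrank ℝ R = X.rank := by
    rw [X.rank_eq_finrank_range_toLin (EuclideanSpace.basisFun (Fin m) ℝ).toBasis
      (EuclideanSpace.basisFun (Fin p) ℝ).toBasis, ← Matrix.toEuclideanLin_eq_toLin_orthonormal]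
  let b := (stdOrthonormalBasis ℝ R).reindex (finCongr hR)
  refine ⟨fun i => (b i : EuclideanSpace ℝ (Fin m)).ofLp, fun i j => ?_, ?_⟩
  · have h := b.inner_eq_ite j i
    rw [Submodule.coe_inner, EuclideanSpace.inner_eq_star_dotProduct] at h
    simpa [eq_comm] using h
  · rintro x ⟨hx, w, hw⟩ g
    let y : R := ⟨WithLp.toLp 2 x, ⟨WithLp.toLp 2 w, by simp [Matrix.toLpLin_apply, hw]⟩⟩
    have hy : ‖y‖ ^ 2 = 1 := by
      rw [← real_inner_self_eq_norm_sq, Submodule.coe_inner,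
        EuclideanSpace.inner_eq_star_dotProduct]
      simpa [y] using hx
    have hsum : x ⬝ᵥ g = ∑ i, inner ℝ (b i) y * ((b i : EuclideanSpace ℝ (Fin m)).ofLp ⬝ᵥ g) := by
      have h1 : (y : EuclideanSpace ℝ (Fin m)).ofLp = x := rfl
      conv_lhs => rw [← h1, ← b.sum_repr' y]
      simp [sum_dotProduct]
    refine Real.le_sqrt_of_sq_le ?_
    rw [hsum, zero_add]
    refine (Finset.sum_mul_sq_le_sq_mul_sq _ _ _).trans_eq ?_
    rw [b.sum_sq_inner_right, hy, one_mul]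

/-- Homogeneity extends the bound from unit vectors; replacing v by -v gives the absolute value. -/
theorem abs_inner_le_of_columnSphere {m n p : ℕ} {X : Matrix (Fin m) (Fin p) ℝ}
    {E : Matrix (Fin m) (Fin n) ℝ} {s : ℝ}
    (h : ∀ x ∈ columnSphere X, ∀ v : Fin n → ℝ, v ⬝ᵥ v = 1 → x ⬝ᵥ (E *ᵥ v) ≤ s)
    (w : EuclideanSpace ℝ (Fin p)) (v : EuclideanSpace ℝ (Fin n)) :
    |inner ℝ (Matrix.toEuclideanLin E v) (Matrix.toEuclideanLin X w)| ≤
      s * ‖Matrix.toEuclideanLin X w‖ * ‖v‖ := by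
  have hself : ∀ {a : ℕ} (u : EuclideanSpace ℝ (Fin a)), u.ofLp ⬝ᵥ u.ofLp = ‖u‖ ^ 2 := by
    intro a u
    rw [← real_inner_self_eq_norm_sq, EuclideanSpace.inner_eq_star_dotProduct]
    simp
  have key : ∀ (w : EuclideanSpace ℝ (Fin p)) (v : EuclideanSpace ℝ (Fin n)),
      inner ℝ (Matrix.toEuclideanLin E v) (Matrix.toEuclideanLin X w) ≤
        s * ‖Matrix.toEuclideanLin X w‖ * ‖v‖ := by
    intro w v
    set y := Matrix.toEuclideanLin X w with hy
    rcases eq_or_ne y 0 with h0 | h0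
    · simp [h0]
    rcases eq_or_ne v 0 with hv0 | hv0
    · simp [hv0]
    have hyp : 0 < ‖y‖ := norm_pos_iff.2 h0
    have hvp : 0 < ‖v‖ := norm_pos_iff.2 hv0
    have hmem : ‖y‖⁻¹ • y.ofLp ∈ columnSphere X := by
      refine ⟨?_, ‖y‖⁻¹ • w.ofLp, ?_⟩
      · rw [smul_dotProduct, dotProduct_smul, hself, smul_eq_mul, smul_eq_mul]
        field_simp
      · rw [Matrix.mulVec_smul, hy, Matrix.toLpLin_apply]
    have hunit : (‖v‖⁻¹ • v.ofLp) ⬝ᵥ (‖v‖⁻¹ • v.ofLp) = 1 := by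
      rw [smul_dotProduct, dotProduct_smul, hself, smul_eq_mul, smul_eq_mul]
      field_simp
    have h1 := h _ hmem _ hunit
    rw [Matrix.mulVec_smul, smul_dotProduct, dotProduct_smul, smul_eq_mul, smul_eq_mul,
      ← mul_assoc, ← mul_inv, inv_mul_le_iff₀ (by positivity)] at h1
    have h2 : inner ℝ (Matrix.toEuclideanLin E v) y = y.ofLp ⬝ᵥ (E *ᵥ v.ofLp) := by
      rw [EuclideanSpace.inner_eq_star_dotProduct, Matrix.toLpLin_apply]
      simp
    rw [h2]
    linarith
  refine abs_le'.2 ⟨key w v, ?_⟩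
  have h1 := key w (-v)
  rwa [map_neg, inner_neg_left, norm_neg] at h1

/-- Writing the noise as σ times a standard Gaussian vector also covers the degenerate case σ = 0.
-/
theorem map_eq_map_gaussPi {Ω ι : Type*} [Fintype ι] [MeasurableSpace Ω] {P : Measure Ω}
    [IsProbabilityMeasure P] {f : ι → Ω → ℝ} {σ : ℝ≥0} (hf : iIndepFun f P)
    (hlaw : ∀ i, HasLaw (f i) (gaussianReal 0 (σ ^ 2)) P) :
    P.map (fun ω i => f i ω) = (gaussPi ι).map fun z i => (σ : ℝ) * z i := by
  rw [hf.map_fun_eq_pi_map fun i => (hlaw i).aemeasurable]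
  have h : (gaussianReal 0 1).map (fun x => (σ : ℝ) * x) = gaussianReal 0 (σ ^ 2) := by
    rw [gaussianReal_map_const_mul]
    congr 1
    · simp
    · ext; simp
  have h1 : ∀ i, P.map (f i) = (gaussianReal 0 1).map (fun x => (σ : ℝ) * x) :=
    fun i => (hlaw i).map_eq.trans h.symm
  simp_rw [h1]
  have : ∀ _ : ι, SigmaFinite ((gaussianReal 0 1).map (fun x => (σ : ℝ) * x)) := fun _ => by
    rw [h]; infer_instance
  exact (Measure.pi_map_pi fun _ => by fun_prop).symm

end NuclearNormRegression

/-! ### Assembly of the probability bound and the oracle inequality. -/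

open NuclearNormRegression

/-- The event `S` is a measurable event on which the oracle inequality holds simultaneously for
every minimizer `Atilde` of the criterion and every comparison matrix `B`. -/
theorem corollary11 {Ω : Type*} [MeasurableSpace Ω] (P : Measure Ω) [IsProbabilityMeasure P]
    (m n p : ℕ) (X : Matrix (Fin m) (Fin p) ℝ) (A : Matrix (Fin p) (Fin n) ℝ)
    (E : Ω → Matrix (Fin m) (Fin n) ℝ) (σ : ℝ≥0)
    (hE_indep : iIndepFun (fun (ij : Fin m × Fin n) (ω : Ω) => E ω ij.1 ij.2) P)
    (hE_law : ∀ (i : Fin m) (j : Fin n), HasLaw (fun ω => E ω i j) (gaussianReal 0 (σ ^ 2)) P)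
    (Y : Ω → Matrix (Fin m) (Fin n) ℝ) (hY : ∀ ω, Y ω = X * A + E ω)
    (θ : ℝ) (hθ : 0 < θ) (τ : ℝ)
    (hτ : τ = (1 + θ) * largestSingularValue X * (σ : ℝ) *
      (Real.sqrt (n : ℝ) + Real.sqrt (X.rank : ℝ))) :
    ∃ S : Set Ω, MeasurableSet S ∧
      S ⊆ {ω | ∀ Atilde : Matrix (Fin p) (Fin n) ℝ, IsNNPEstimator X (Y ω) τ Atilde →
        ∀ B : Matrix (Fin p) (Fin n) ℝ,
          ‖X * Atilde - X * A‖ ^ 2 ≤ ‖X * B - X * A‖ ^ 2 + 4 * τ * nuclearNorm B} ∧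
      1 - Real.exp (-(θ ^ 2 * ((n : ℝ) + (X.rank : ℝ)) / 2)) ≤ P.real S := by
  obtain ⟨e, he, hWe⟩ := exists_orthonormal_columnSphere X
  set r := √(n : ℝ) + √(X.rank : ℝ) with hr
  have hr0 : 0 ≤ r := by positivity
  have hl : 0 ≤ θ * r := by positivity
  -- The choice l = θr makes the threshold r + l equal to (1 + θ)r, as in τ.
  have htail := gaussPi_real_exists_mem_lt_le (ν := Fin n) he (W := columnSphere X)
    (fun x hx => hx.1) hWe hl
  simp only [Fintype.card_fin] at htail
  let good : ℝ → Set (Fin m × Fin n → ℝ) := fun s =>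
    {y | ∀ x ∈ columnSphere X, ∀ v : Fin n → ℝ, v ⬝ᵥ v = 1 → tensorVec x v ⬝ᵥ y ≤ s}
  have hgood : ∀ s, MeasurableSet (good s) := by
    intro s
    have : good s = ⋂ x ∈ columnSphere X, ⋂ v : Fin n → ℝ, ⋂ _ : v ⬝ᵥ v = 1,
        {y | tensorVec x v ⬝ᵥ y ≤ s} := by
      ext y; simp [good]
    rw [this]
    refine IsClosed.measurableSet ?_
    refine isClosed_biInter fun x _ => isClosed_iInter fun v => isClosed_iInter fun _ =>
      isClosed_le (by unfold dotProduct; fun_prop) continuous_const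
  let y : Ω → Fin m × Fin n → ℝ := fun ω ij => E ω ij.1 ij.2
  have hym : AEMeasurable y P := aemeasurable_pi_lambda _ fun ij => (hE_law ij.1 ij.2).aemeasurable
  set s := (σ : ℝ) * (r + θ * r) with hs
  have hs0 : 0 ≤ s := by positivity
  -- The entries are only a.e. measurable, so the good event is replaced by a measurable subset of
  -- the same probability.
  obtain ⟨S, hSsub, hSm, hSae⟩ :=
    (hym.nullMeasurableSet_preimage (hgood s)).exists_measurable_subset_ae_eq
  refine ⟨S, hSm, fun ω hω Atilde hA B => ?_, ?_⟩
  · have hgω : y ω ∈ good s := hSsub hω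
    have hE : ∀ x ∈ columnSphere X, ∀ v : Fin n → ℝ, v ⬝ᵥ v = 1 → x ⬝ᵥ (E ω *ᵥ v) ≤ s := by
      intro x hx v hv
      refine le_of_eq_of_le ?_ (hgω x hx v hv)
      simp only [dotProduct, Matrix.mulVec, tensorVec, Fintype.sum_prod_type, Finset.mul_sum, y]
      exact Finset.sum_congr rfl fun i _ => Finset.sum_congr rfl fun j _ => by ring
    have hτs : τ = largestSingularValue X * s := by rw [hτ, hs]; ring
    rw [hY] at hA
    refine oracle_inequality_of_abs_sum_mul_le (fun C => ?_) hA B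
    rw [hτs]
    exact abs_sum_mul_le_nuclearNorm hs0 (abs_inner_le_of_columnSphere hE) C
  · have hP : P.real S = (gaussPi (Fin m × Fin n)).real {z | (fun i => (σ : ℝ) * z i) ∈ good s} := by
      rw [measureReal_def, measure_congr hSae, ← Measure.map_apply_of_aemeasurable hym (hgood s),
        map_eq_map_gaussPi hE_indep fun ij => hE_law ij.1 ij.2,
        Measure.map_apply (by fun_prop) (hgood s)]
      rfl
    -- Inclusion is enough, and no division by σ is needed.
    have hsub : (good (r + θ * r)) ⊆ {z | (fun i => (σ : ℝ) * z i) ∈ good s} := by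
      intro z hz x hx v hv
      have h1 : tensorVec x v ⬝ᵥ (fun i => (σ : ℝ) * z i) = σ * (tensorVec x v ⬝ᵥ z) :=
        dotProduct_smul (σ : ℝ) (tensorVec x v) z
      rw [h1]
      exact mul_le_mul_of_nonneg_left (hz x hx v hv) σ.2
    have hcompl : {z | ∃ x ∈ columnSphere X, ∃ v : Fin n → ℝ, v ⬝ᵥ v = 1 ∧
        r + θ * r < tensorVec x v ⬝ᵥ z} = (good (r + θ * r))ᶜ := by
      ext z; simp [good]
    rw [hcompl, probReal_compl_eq_one_sub (hgood _)] at htail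
    -- Here (√n + √q)² ≥ n + q: the proof gives slightly more than is claimed.
    have hexp : Real.exp (-((θ * r) ^ 2 / 2)) ≤
        Real.exp (-(θ ^ 2 * ((n : ℝ) + (X.rank : ℝ)) / 2)) := by
      refine Real.exp_le_exp.2 (neg_le_neg (div_le_div_of_nonneg_right ?_ zero_le_two))
      rw [mul_pow]
      refine mul_le_mul_of_nonneg_left ?_ (sq_nonneg θ)
      have h1 := Real.sq_sqrt (Nat.cast_nonneg (α := ℝ) n)
      have h2 := Real.sq_sqrt (Nat.cast_nonneg (α := ℝ) X.rank)
      have h3 : 0 ≤ √(n : ℝ) * √(X.rank : ℝ) := by positivity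
      rw [hr, add_sq]
      linarith
    rw [hP]
    have := measureReal_mono (μ := gaussPi (Fin m × Fin n)) hsub
    linarith
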